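/- Let $\mathbf A=\mathbb Z[u,u^{-1}]$, $K=\mathbb Q(u)$, $[2]=u+u^{-1}$, and let $H_3$ be the Hecke algebra of the symmetric group $S_3$ over $\mathbf A$, generated by elements $T_w$, $w\in S_3$, with $T_{1}=1$, $T_vT_w=T_{vw}$ whenever $\ell(vw)=\ell(v)+\ell(w)$, and $(T_s-u)(T_s+u^{-1})=0$ for the two simple reflections $s=s_1,s_2$. Put $p_+=[2]^{-1}(T_s+u^{-1})$ and $p_-=-[2]^{-1}(T_s-u)$. For $k\ge 0$ let $\mathcal P^{(k)}_s\in H_3^{\otimes k}$ be $[2]^k$ times the sum of $p_{a_1}\otimes\cdots\otimes p_{a_k}$ over all sign vectors $a\in\{+,-\}^k$ with an even number of minus signs, let $\bar H^{(k)}_3$ be the $\mathbf A$-subalgebra of $H_3^{\otimes k}$ generated by $\mathcal P^{(k)}_{1}=\mathcal P^{(k)}_{s_1}$ and $\mathcal P^{(k)}_{2}=\mathcal P^{(k)}_{s_2}$, and let $K\bar H^{(k)}_3=K\otimes_{\mathbf A}\bar H^{(k)}_3$. For $k=m+n$ there is an inclusion $K\bar H^{(k)}_3\hookrightarrow K\bar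 H^{(m)}_3\otimes_K K\bar H^{(n)}_3$, induced by $H_3^{\otimes k}= H_3^{\otimes m}\otimes H_3^{\otimes n}$ and given by $\mathcal P^{(k)}_s\mapsto \mathcal P^{(m)}_s\otimes\mathcal P^{(n)}_s+([2]^m-\mathcal P^{(m)}_s)\otimes([2]^n-\mathcal P^{(n)}_s)$; along it the tensor product of a representation of $K\bar H^{(m)}_3$ and a representation of $K\bar H^{(n)}_3$ is a representation of $K\bar H^{(k)}_3$. Let $\epsilon_+$ be the one-dimensional representation $T_w\mapsto u^{\ell(w)}$ of $H_3$. For every $k\ge 1$ there are one-dimensional representations $\bar\epsilon_+,\bar\epsilon_-$ of $K\bar H^{(k)}_3$ with $\bar\epsilon_+(\mathcal P^{(k)}_i)=[2]^k$ and $\bar\epsilon_-(\mathcal P^{(k)}_i)=0$ for $i=1,2$ (the trivial and the sign representation), and for every $j\ge1$ there is a representation $\bar M^{(j)}$ of $K\bar H^{(j)}_3$ on $K^2$ with $$\mathcal P^{(j)}_1\mapsto\begin{pmatrix}[2]^j&c_j\\0&0\end{pmatrix},\qquad \mathcal P^{(j)}_2\mapsto\begin{pmatrix}0&0\\1&[2]^j\end{pmatrix},\qquad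 c_j=\bigl([2]^j\,T_j(1/[2])\bigr)^2,$$ where $T_j$ is the $j$-th Chebyshev polynomial of the first kind. The irreducible representations of $K\bar H^{(k)}_3$ are, up to isomorphism and without repetition, $\bar\epsilon_+$, $\bar\epsilon_-$ and the $k$ two-dimensional representations $\epsilon_+^{\otimes (k-j)}\otimes\bar M^{(j)}$, $j=1,\dots,k$. -/

import Mathlib

open scoped TensorProduct LaurentPolynomial

noncomputable section

namespace NonstandardHecke

/-- The ground ring `ℤ[u, u⁻¹]` of Laurent polynomials; the indeterminate `u` is `LaurentPolynomial.T 1`. -/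
abbrev Ground : Type := ℤ[T;T⁻¹]

/-- The indeterminate `u`. -/
def u : Ground := LaurentPolynomial.T 1

/-- The inverse `u⁻¹` of the indeterminate. -/
def uInv : Ground := LaurentPolynomial.T (-1)

/-- The quantum integer `[2] = u + u⁻¹`. -/
def qTwo : Ground := u + uInv

/-! ### Extension of scalars and tensor products -/

section BaseChange

variable (R : Type) [CommRing R] (K : Type) [Field K] [Algebra R K]
variable (X Y : Type) [Ring X] [Algebra R X] [Ring Y] [Algebra R Y]

theorem ofId_commute {Z : Type} [Ring Z] [Algebra K Z] (c : K) (z : Z) :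
    Commute (Algebra.ofId K Z c) z :=
  Algebra.commute_algebraMap_left c z

/-- The `K`-linear extension `c ⊗ x ↦ c f(x)` of a homomorphism `f` of `R`-algebras. -/
def extendScalars {X Z : Type} [Semiring X] [Algebra R X] [Ring Z] [Algebra R Z] [Algebra K Z]
    [IsScalarTower R K Z] (f : X →ₐ[R] Z) : K ⊗[R] X →ₐ[K] Z :=
  Algebra.TensorProduct.lift (Algebra.ofId K Z) f (fun c x => ofId_commute K c (f x))

theorem extendScalars_tmul {X Z : Type} [Semiring X] [Algebra R X] [Ring Z] [Algebra R Z] [Algebra K Z]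
    [IsScalarTower R K Z] (f : X →ₐ[R] Z) (x : X) :
    extendScalars R K f (1 ⊗ₜ[R] x) = f x := by
  rw [extendScalars, Algebra.TensorProduct.lift_tmul, map_one, one_mul]

/-- The homomorphism `X → (K ⊗ X) ⊗ (K ⊗ Y)`, `x ↦ (1 ⊗ x) ⊗ 1`. -/
def inclLeft : X →ₐ[R] (K ⊗[R] X) ⊗[K] (K ⊗[R] Y) :=
  ((Algebra.TensorProduct.includeLeft (R := K) (S := K)
    (A := K ⊗[R] X) (B := K ⊗[R] Y)).restrictScalars R).comp
      (Algebra.TensorProduct.includeRight (R := R) (A := K) (B := X))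

/-- The homomorphism `Y → (K ⊗ X) ⊗ (K ⊗ Y)`, `y ↦ 1 ⊗ (1 ⊗ y)`. -/
def inclRight : Y →ₐ[R] (K ⊗[R] X) ⊗[K] (K ⊗[R] Y) :=
  ((Algebra.TensorProduct.includeRight (R := K)
    (A := K ⊗[R] X) (B := K ⊗[R] Y)).restrictScalars R).comp
      (Algebra.TensorProduct.includeRight (R := R) (A := K) (B := Y))

theorem inclLeft_mul_inclRight (x : X) (y : Y) :
    inclLeft R K X Y x * inclRight R K X Y y =
      ((1 : K) ⊗ₜ[R] x) ⊗ₜ[K] ((1 : K) ⊗ₜ[R] y) :=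
  (Algebra.TensorProduct.tmul_mul_tmul _ _ _ _).trans (by rw [one_mul, mul_one]; rfl)

theorem inclRight_mul_inclLeft (x : X) (y : Y) :
    inclRight R K X Y y * inclLeft R K X Y x =
      ((1 : K) ⊗ₜ[R] x) ⊗ₜ[K] ((1 : K) ⊗ₜ[R] y) :=
  (Algebra.TensorProduct.tmul_mul_tmul _ _ _ _).trans (by rw [one_mul, mul_one]; rfl)

theorem inclLeft_commute_inclRight (x : X) (y : Y) :
    Commute (inclLeft R K X Y x) (inclRight R K X Y y) :=
  (inclLeft_mul_inclRight R K X Y x y).trans (inclRight_mul_inclLeft R K X Y x y).symm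

/-- The canonical homomorphism `K ⊗ (X ⊗ Y) → (K ⊗ X) ⊗ (K ⊗ Y)`,
`c ⊗ (x ⊗ y) ↦ c ((1 ⊗ x) ⊗ (1 ⊗ y))`. -/
def baseChangeSplit : K ⊗[R] (X ⊗[R] Y) →ₐ[K] (K ⊗[R] X) ⊗[K] (K ⊗[R] Y) :=
  extendScalars R K (Algebra.TensorProduct.lift (inclLeft R K X Y) (inclRight R K X Y)
    (inclLeft_commute_inclRight R K X Y))

theorem baseChangeSplit_tmul (x : X) (y : Y) :
    baseChangeSplit R K X Y (1 ⊗ₜ[R] (x ⊗ₜ[R] y)) =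
      ((1 : K) ⊗ₜ[R] x) ⊗ₜ[K] ((1 : K) ⊗ₜ[R] y) := by
  rw [baseChangeSplit, extendScalars_tmul, Algebra.TensorProduct.lift_tmul,
    inclLeft_mul_inclRight]

theorem baseChangeSplit_add (x x' : X) (y y' : Y) :
    baseChangeSplit R K X Y (1 ⊗ₜ[R] (x ⊗ₜ[R] y + x' ⊗ₜ[R] y')) =
      ((1 : K) ⊗ₜ[R] x) ⊗ₜ[K] ((1 : K) ⊗ₜ[R] y) + ((1 : K) ⊗ₜ[R] x') ⊗ₜ[K] ((1 : K) ⊗ₜ[R] y') := by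
  rw [TensorProduct.tmul_add, map_add, baseChangeSplit_tmul, baseChangeSplit_tmul]

theorem map_tensor_add {X Y X' Y' : Type} [Ring X] [Algebra K X] [Ring Y] [Algebra K Y]
    [Ring X'] [Algebra K X'] [Ring Y'] [Algebra K Y'] (f : X →ₐ[K] X') (g : Y →ₐ[K] Y')
    (x₁ x₂ : X) (y₁ y₂ : Y) :
    Algebra.TensorProduct.map f g (x₁ ⊗ₜ[K] y₁ + x₂ ⊗ₜ[K] y₂) =
      f x₁ ⊗ₜ[K] g y₁ + f x₂ ⊗ₜ[K] g y₂ := by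
  simp

end BaseChange

/-! ### Hecke algebras of Coxeter systems -/

section Hecke

variable {B W : Type} [Group W] {M : CoxeterMatrix B} (cs : CoxeterSystem M W)

/-- The defining relations of the Hecke algebra on the symbols `T_w`, `w ∈ W`: `T_1` is the unit,
`T_v T_w = T_{vw}` if lengths add, and `(T_s - u) (T_s + u⁻¹) = 0` for simple reflections `s`. -/
inductive HeckeRel : FreeAlgebra Ground W → FreeAlgebra Ground W → Prop
  | one : HeckeRel (FreeAlgebra.ι Ground 1) 1
  | mul (v w : W) (h : cs.length (v * w) = cs.length v + cs.length w) :
      HeckeRel (FreeAlgebra.ι Ground v * FreeAlgebra.ι Ground w) (FreeAlgebra.ι Ground (v * w))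
  | quadratic (i : B) :
      HeckeRel
        ((FreeAlgebra.ι Ground (cs.simple i) - algebraMap Ground _ u) *
          (FreeAlgebra.ι Ground (cs.simple i) + algebraMap Ground _ uInv)) 0

/-- The Hecke algebra `H_W` over `ℤ[u, u⁻¹]`, on the generators `T_w`, `w ∈ W`, with the relations
above. -/
def HeckeAlgebra : Type := RingQuot (HeckeRel cs)

instance : Ring (HeckeAlgebra cs) := inferInstanceAs (Ring (RingQuot (HeckeRel cs)))

instance : Algebra Ground (HeckeAlgebra cs) :=
  inferInstanceAs (Algebra Ground (RingQuot (HeckeRel cs)))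

/-- The standard basis element `T_w` of the Hecke algebra. -/
def heckeT (w : W) : HeckeAlgebra cs :=
  RingQuot.mkAlgHom Ground (HeckeRel cs) (FreeAlgebra.ι Ground w)

/-- The unsigned Kazhdan-Lusztig element `C'_s = T_s + u⁻¹`; it is `[2] p₊`. -/
def cPrime (i : B) : HeckeAlgebra cs :=
  heckeT cs (cs.simple i) + algebraMap Ground (HeckeAlgebra cs) uInv

/-- The signed Kazhdan-Lusztig element `C_s = T_s - u`; it is `-[2] p₋`. -/
def cSigned (i : B) : HeckeAlgebra cs :=
  heckeT cs (cs.simple i) - algebraMap Ground (HeckeAlgebra cs) u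

/-- The trivial representation `ε₊ : H_W → ℤ[u, u⁻¹]`, `T_w ↦ u ^ ℓ(w)`. -/
def heckeTrivial : HeckeAlgebra cs →ₐ[Ground] Ground :=
  RingQuot.liftAlgHom Ground
    ⟨FreeAlgebra.lift Ground (fun w : W => (LaurentPolynomial.T (cs.length w : ℤ) : Ground)), by
      intro x y h
      induction h with
      | one => simp
      | mul v w h =>
        simp only [map_mul, FreeAlgebra.lift_ι_apply]
        rw [h, Nat.cast_add, LaurentPolynomial.T_add]
      | quadratic i => simp [u]⟩

theorem heckeTrivial_heckeT (w : W) :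
    heckeTrivial cs (heckeT cs w) = LaurentPolynomial.T (cs.length w : ℤ) := by
  unfold heckeTrivial heckeT
  erw [RingQuot.liftAlgHom_mkAlgHom_apply]
  simp

/-! ### Nonstandard Hecke algebras -/

/-- The `k`-fold tensor power `H_W ⊗ ⋯ ⊗ H_W` over `ℤ[u, u⁻¹]`. -/
abbrev HeckePow (k : ℕ) : Type := ⨂[Ground] _ : Fin k, HeckeAlgebra cs

/-- `[2] p₊ = C'_s` (for `true`) and `[2] p₋ = -C_s` (for `false`). -/
def signElt (i : B) : Bool → HeckeAlgebra cs
  | true => cPrime cs i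
  | false => -cSigned cs i

/-- A sign vector is even if the number of its minus signs is even. -/
def EvenSigns {ι : Type} [Fintype ι] (a : ι → Bool) : Prop :=
  Even (Finset.univ.filter fun i => a i = false).card

instance {ι : Type} [Fintype ι] (a : ι → Bool) : Decidable (EvenSigns a) :=
  inferInstanceAs (Decidable (Even _))

/-- The element `P_s^{(k)} = [2]^k Δ_s^{(k)}(p₊)` of the `k`-th tensor power of `H_W`: the sum of
all pure tensors `[2] p_{a_1} ⊗ ⋯ ⊗ [2] p_{a_k}` over the sign vectors `a` with an even number of
minus signs. -/
def powP (k : ℕ) (i : B) : HeckePow cs k :=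
  ∑ a : Fin k → Bool with EvenSigns a,
    PiTensorProduct.tprod Ground fun j => signElt cs i (a j)

/-- The element `Q_s^{(k)} = [2]^k - P_s^{(k)}`. -/
def powQ (k : ℕ) (i : B) : HeckePow cs k :=
  algebraMap Ground (HeckePow cs k) (qTwo ^ k) - powP cs k i

/-- The nonstandard Hecke algebra: the subalgebra of the `k`-th tensor power of `H_W` generated by
the elements `P_s^{(k)}`, for all simple reflections `s`. -/
def nonstandardHecke (k : ℕ) : Subalgebra Ground (HeckePow cs k) :=
  Algebra.adjoin Ground (Set.range (powP cs k))

/-- The generator `P_s^{(k)}` as an element of the nonstandard Hecke algebra. -/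
def genP (k : ℕ) (i : B) : nonstandardHecke cs k :=
  ⟨powP cs k i, Algebra.subset_adjoin ⟨i, rfl⟩⟩

/-- The element `Q_s^{(k)} = [2]^k - P_s^{(k)}` of the nonstandard Hecke algebra. -/
def genQ (k : ℕ) (i : B) : nonstandardHecke cs k :=
  algebraMap Ground (nonstandardHecke cs k) (qTwo ^ k) - genP cs k i

theorem coe_genQ (k : ℕ) (i : B) :
    ((genQ cs k i : nonstandardHecke cs k) : HeckePow cs k) = powQ cs k i := rfl

/-- The representation `ε₊ ⊗ ⋯ ⊗ ε₊` (`k` factors) of the `k`-th tensor power of `H_W`. -/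
def heckePowTrivial (k : ℕ) : HeckePow cs k →ₐ[Ground] Ground :=
  PiTensorProduct.liftAlgHom
    ((MultilinearMap.mkPiAlgebra Ground (Fin k) Ground).compLinearMap
      fun _ => (heckeTrivial cs).toLinearMap)
    (by simp) (by intro x y; simp [Finset.prod_mul_distrib])

/-! ### The inclusion of `H^{(k)}` into `H^{(m)} ⊗ H^{(n)}`, where `m + n = k` -/

/-- The first `m` and the last `n` of `k = m + n` positions. -/
def splitEquiv {m n k : ℕ} (h : m + n = k) : Fin m ⊕ Fin n ≃ Fin k :=
  finSumFinEquiv.trans (finCongr h)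

/-- The identification of the `k`-th tensor power of `H_W` with the tensor product of the `m`-th
and the `n`-th one, `k = m + n`, as a homomorphism of algebras. -/
def splitHom {m n k : ℕ} (h : m + n = k) :
    HeckePow cs k →ₐ[Ground] HeckePow cs m ⊗[Ground] HeckePow cs n :=
  PiTensorProduct.liftAlgHom
    (((PiTensorProduct.tprod Ground (s := fun _ : Fin m => HeckeAlgebra cs)).domCoprod
      (PiTensorProduct.tprod Ground (s := fun _ : Fin n => HeckeAlgebra cs))).domDomCongr
        (splitEquiv h))
    (by rfl)
    (by
      intro x y
      simp only [MultilinearMap.domDomCongr_apply, MultilinearMap.domCoprod_apply,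
        Algebra.TensorProduct.tmul_mul_tmul, PiTensorProduct.tprod_mul_tprod]
      rfl)

theorem splitHom_tprod {m n k : ℕ} (h : m + n = k) (x : Fin k → HeckeAlgebra cs) :
    splitHom cs h (PiTensorProduct.tprod Ground x) =
      PiTensorProduct.tprod Ground (fun i => x (splitEquiv h (Sum.inl i))) ⊗ₜ[Ground]
        PiTensorProduct.tprod Ground (fun i => x (splitEquiv h (Sum.inr i))) := by
  unfold splitHom
  simp [PiTensorProduct.liftAlgHom, MultilinearMap.domCoprod_apply]

theorem powQ_eq (k : ℕ) (i : B) :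
    powQ cs k i = ∑ a : Fin k → Bool with ¬ EvenSigns a,
      PiTensorProduct.tprod Ground fun j => signElt cs i (a j) := by
  have hs : ∑ b : Bool, signElt cs i b = qTwo • (1 : HeckeAlgebra cs) := by
    simp only [Fintype.sum_bool, signElt, cPrime, cSigned, qTwo, Algebra.algebraMap_eq_smul_one]
    rw [add_smul]
    abel
  have htot : ∑ a : Fin k → Bool, PiTensorProduct.tprod Ground (fun j => signElt cs i (a j)) =
      algebraMap Ground (HeckePow cs k) (qTwo ^ k) := by
    rw [← MultilinearMap.map_sum (PiTensorProduct.tprod Ground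
      (s := fun _ : Fin k => HeckeAlgebra cs)) (fun _ b => signElt cs i b)]
    simp only [hs]
    rw [MultilinearMap.map_smul_univ (PiTensorProduct.tprod Ground
      (s := fun _ : Fin k => HeckeAlgebra cs)) (fun _ => qTwo) (fun _ => 1)]
    simp only [Finset.prod_const, Finset.card_univ, Fintype.card_fin]
    rw [Algebra.algebraMap_eq_smul_one]
    rfl
  rw [powQ, powP, ← htot, sub_eq_iff_eq_add,
    add_comm, Finset.sum_filter_add_sum_filter_not]

theorem evenSigns_split {m n k : ℕ} (h : m + n = k) (a : Fin k → Bool) :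
    EvenSigns a ↔ (EvenSigns (fun i => a (splitEquiv h (Sum.inl i))) ↔
      EvenSigns (fun i => a (splitEquiv h (Sum.inr i)))) := by
  have : (Finset.univ.filter fun i => a i = false).card =
      (Finset.univ.filter fun i => a (splitEquiv h (Sum.inl i)) = false).card +
      (Finset.univ.filter fun i => a (splitEquiv h (Sum.inr i)) = false).card := by
    simp only [Finset.card_filter]
    rw [← (splitEquiv h).sum_comp, Fintype.sum_sum_type]
  unfold EvenSigns
  rw [this, Nat.even_add]

theorem splitHom_powP {m n k : ℕ} (h : m + n = k) (i : B) :
    splitHom cs h (powP cs k i) =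
      powP cs m i ⊗ₜ[Ground] powP cs n i + powQ cs m i ⊗ₜ[Ground] powQ cs n i := by
  rw [powQ_eq, powQ_eq]
  simp only [powP, map_sum, splitHom_tprod, TensorProduct.sum_tmul, TensorProduct.tmul_sum]
  simp only [Finset.sum_filter]
  let e : (Fin k → Bool) ≃ (Fin m → Bool) × (Fin n → Bool) :=
    ((splitEquiv h).symm.arrowCongr (Equiv.refl Bool)).trans (Equiv.sumArrowEquivProdArrow _ _ _)
  have he1 : ∀ a, (e a).1 = fun i => a (splitEquiv h (Sum.inl i)) := fun a => rfl
  have he2 : ∀ a, (e a).2 = fun i => a (splitEquiv h (Sum.inr i)) := fun a => rfl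
  let F : (Fin m → Bool) × (Fin n → Bool) → HeckePow cs m ⊗[Ground] HeckePow cs n := fun p =>
    if (EvenSigns p.1 ↔ EvenSigns p.2) then
      PiTensorProduct.tprod Ground (fun j => signElt cs i (p.1 j)) ⊗ₜ[Ground]
        PiTensorProduct.tprod Ground (fun j => signElt cs i (p.2 j)) else 0
  have h1 : ∀ a : Fin k → Bool, (if EvenSigns a then
      PiTensorProduct.tprod Ground (fun j => signElt cs i (a (splitEquiv h (Sum.inl j))))
        ⊗ₜ[Ground]
      PiTensorProduct.tprod Ground (fun j => signElt cs i (a (splitEquiv h (Sum.inr j)))) else 0)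
      = F (e a) := by
    intro a
    simp only [F, he1, he2, evenSigns_split h a]
  rw [Finset.sum_congr rfl (fun a _ => h1 a), e.sum_comp F, Fintype.sum_prod_type_right,
    ← Finset.sum_add_distrib]
  apply Finset.sum_congr rfl
  intro c _
  by_cases hc : EvenSigns c <;> simp [F, hc]

variable (K : Type) [Field K] [Algebra Ground K]

/-- The specialization `K H^{(k)} = K ⊗ H^{(k)}` of the nonstandard Hecke algebra. -/
abbrev NSHecke (k : ℕ) : Type := K ⊗[Ground] nonstandardHecke cs k

/-- The generator `P_s^{(k)}` of `K H^{(k)}`. -/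
def P (k : ℕ) (i : B) : NSHecke cs K k := 1 ⊗ₜ[Ground] genP cs k i

/-- The element `Q_s^{(k)} = [2]^k - P_s^{(k)}` of `K H^{(k)}`. -/
def Q (k : ℕ) (i : B) : NSHecke cs K k := 1 ⊗ₜ[Ground] genQ cs k i

/-- The map `K H^{(k)} → K ⊗ H_W^{⊗ k}` induced by the inclusion. -/
def baseIncl (k : ℕ) : NSHecke cs K k →ₐ[K] K ⊗[Ground] HeckePow cs k :=
  Algebra.TensorProduct.map (AlgHom.id K K) (nonstandardHecke cs k).val

/-- The identification of `splitHom`, followed by extension of scalars to `K`. -/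
def baseSplit {m n k : ℕ} (h : m + n = k) : K ⊗[Ground] HeckePow cs k →ₐ[K]
    (K ⊗[Ground] HeckePow cs m) ⊗[K] (K ⊗[Ground] HeckePow cs n) :=
  (baseChangeSplit Ground K (HeckePow cs m) (HeckePow cs n)).comp
    (Algebra.TensorProduct.map (AlgHom.id K K) (splitHom cs h))

/-- The map `K H^{(m)} ⊗ K H^{(n)} → (K ⊗ H_W^{⊗ m}) ⊗ (K ⊗ H_W^{⊗ n})` induced by the
inclusions. -/
def tensorIncl (m n : ℕ) : NSHecke cs K m ⊗[K] NSHecke cs K n →ₐ[K]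
    (K ⊗[Ground] HeckePow cs m) ⊗[K] (K ⊗[Ground] HeckePow cs n) :=
  Algebra.TensorProduct.map (baseIncl cs K m) (baseIncl cs K n)

theorem tensorIncl_P {m n k : ℕ} (h : m + n = k) (i : B) :
    tensorIncl cs K m n (P cs K m i ⊗ₜ[K] P cs K n i + Q cs K m i ⊗ₜ[K] Q cs K n i) =
      baseSplit cs K h (baseIncl cs K k (P cs K k i)) := by
  have h1 : ∀ k, baseIncl cs K k (P cs K k i) = 1 ⊗ₜ[Ground] powP cs k i := fun k => rfl
  have h2 : ∀ k, baseIncl cs K k (Q cs K k i) = 1 ⊗ₜ[Ground] powQ cs k i := fun k => rfl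
  have h3 : ∀ x, baseSplit cs K h (1 ⊗ₜ[Ground] x) =
      baseChangeSplit Ground K (HeckePow cs m) (HeckePow cs n) (1 ⊗ₜ[Ground] splitHom cs h x) :=
    fun x => rfl
  rw [h1, h3, splitHom_powP, baseChangeSplit_add, ← h1, ← h1, ← h2, ← h2]
  exact map_tensor_add K (baseIncl cs K m) (baseIncl cs K n) _ _ _ _

theorem baseIncl_mem_range {m n k : ℕ} (h : m + n = k) (x : NSHecke cs K k) :
    (baseSplit cs K h).comp (baseIncl cs K k) x ∈ (tensorIncl cs K m n).range := by
  induction x using TensorProduct.induction_on with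
  | zero => rw [map_zero]; exact zero_mem _
  | add x y hx hy => rw [map_add]; exact add_mem hx hy
  | tmul c x =>
    have hx : ∀ x : nonstandardHecke cs k,
        (baseSplit cs K h).comp (baseIncl cs K k) (1 ⊗ₜ[Ground] x) ∈
          (tensorIncl cs K m n).range := by
      rintro ⟨x, hx⟩
      let f : HeckePow cs k →ₐ[Ground] _ :=
        ((baseSplit cs K h).restrictScalars Ground).comp
          (Algebra.TensorProduct.includeRight (R := Ground) (A := K) (B := HeckePow cs k))
      have hle : nonstandardHecke cs k ≤
          (((tensorIncl cs K m n).range).restrictScalars Ground).comap f := by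
        refine Algebra.adjoin_le ?_
        rintro _ ⟨i, rfl⟩
        exact ⟨_, tensorIncl_P cs K h i⟩
      exact hle hx
    have : c ⊗ₜ[Ground] x = c • ((1 : K) ⊗ₜ[Ground] x) := by
      rw [TensorProduct.smul_tmul', smul_eq_mul, mul_one]
    rw [this, map_smul]
    exact Subalgebra.smul_mem _ (hx x) c

variable [IsFractionRing Ground K]

theorem baseIncl_injective (k : ℕ) : Function.Injective (baseIncl cs K k) := by
  have : Module.Flat Ground K := IsLocalization.flat K (nonZeroDivisors Ground)
  exact Module.Flat.lTensor_preserves_injective_linearMap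
    (nonstandardHecke cs k).val.toLinearMap Subtype.val_injective

theorem tensorIncl_injective (m n : ℕ) : Function.Injective (tensorIncl cs K m n) :=
  TensorProduct.map_injective_of_flat_flat (baseIncl cs K m).toLinearMap
    (baseIncl cs K n).toLinearMap (baseIncl_injective cs K m) (baseIncl_injective cs K n)

/-- The inclusion `K H^{(k)} → K H^{(m)} ⊗ K H^{(n)}`, where `m + n = k`: the restriction of the
identification of `H_W^{⊗ k}` with `H_W^{⊗ m} ⊗ H_W^{⊗ n}`. -/
def coproduct {m n k : ℕ} (h : m + n = k) :
    NSHecke cs K k →ₐ[K] NSHecke cs K m ⊗[K] NSHecke cs K n :=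
  (AlgEquiv.ofInjective (tensorIncl cs K m n) (tensorIncl_injective cs K m n)).symm.toAlgHom.comp
    (((baseSplit cs K h).comp (baseIncl cs K k)).codRestrict _ (baseIncl_mem_range cs K h))

theorem coproduct_P {m n k : ℕ} (h : m + n = k) (i : B) :
    coproduct cs K h (P cs K k i) =
      P cs K m i ⊗ₜ[K] P cs K n i + Q cs K m i ⊗ₜ[K] Q cs K n i := by
  apply tensorIncl_injective cs K m n
  rw [tensorIncl_P cs K h]
  have := congrArg Subtype.val ((AlgEquiv.ofInjective (tensorIncl cs K m n)
    (tensorIncl_injective cs K m n)).apply_symm_apply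
      (((baseSplit cs K h).comp (baseIncl cs K k)).codRestrict _ (baseIncl_mem_range cs K h)
        (P cs K k i)))
  exact this

end Hecke

/-! ### Representations -/

section Rep

variable {K : Type} [Field K] {R : Type} [Ring R] [Algebra K R]

/-- A representation of a `K`-algebra `R` on a `K`-vector space `V`. -/
abbrev Rep (K R V : Type) [Field K] [Ring R] [Algebra K R] [AddCommGroup V] [Module K V] : Type :=
  R →ₐ[K] Module.End K V

/-- The space of a representation, viewed as a left `R`-module. -/
def RepSpace {V : Type} [AddCommGroup V] [Module K V] (_ρ : Rep K R V) : Type := V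

instance {V : Type} [AddCommGroup V] [Module K V] (ρ : Rep K R V) : AddCommGroup (RepSpace ρ) :=
  inferInstanceAs (AddCommGroup V)

instance {V : Type} [AddCommGroup V] [Module K V] (ρ : Rep K R V) : Module R (RepSpace ρ) :=
  Module.compHom V ρ.toRingHom

/-- The one-dimensional representation on `K` given by a homomorphism to `K`. -/
def charRep (χ : R →ₐ[K] K) : Rep K R K := (Algebra.lmul K K).comp χ

end Rep

section Tensor

variable {B W : Type} [Group W] {M : CoxeterMatrix B} (cs : CoxeterSystem M W)
variable (K : Type) [Field K] [Algebra Ground K]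

/-- The restriction of `ε₊ ⊗ ⋯ ⊗ ε₊` (`k` factors) to the nonstandard Hecke algebra. -/
def nsTrivial (k : ℕ) : nonstandardHecke cs k →ₐ[Ground] Ground :=
  (heckePowTrivial cs k).comp (nonstandardHecke cs k).val

/-- The one-dimensional representation `ε₊ ⊗ ⋯ ⊗ ε₊` (`k` factors) of `K H^{(k)}`, the restriction
of the one of the `k`-th tensor power of `H_W`. -/
def epsPlusPow (k : ℕ) : Rep K (NSHecke cs K k) K :=
  charRep (extendScalars Ground K ((Algebra.ofId Ground K).comp (nsTrivial cs k)))

variable {K} [IsFractionRing Ground K]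

/-- The tensor product of a representation of `K H^{(m)}` and one of `K H^{(n)}`, restricted to
`K H^{(k)}` along the inclusion, where `m + n = k`. -/
def tensorRep {m n k : ℕ} (h : m + n = k) {V V' : Type} [AddCommGroup V] [Module K V]
    [AddCommGroup V'] [Module K V'] (ρ : Rep K (NSHecke cs K m) V)
    (σ : Rep K (NSHecke cs K n) V') : Rep K (NSHecke cs K k) (V ⊗[K] V') :=
  ((Module.endTensorEndAlgHom (R := K) (S := K) (A := K) (M := V) (N := V')).comp
    (Algebra.TensorProduct.map ρ σ)).comp (coproduct cs K h)

/-- The representation `ε₊ ⊗ ⋯ ⊗ ε₊ ⊗ σ` of `K H^{(k)}` with `k - j` factors `ε₊`, for a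
representation `σ` of `K H^{(j)}`, `j ≤ k`. -/
def trivTensor {j k : ℕ} (hj : j ≤ k) {V : Type} [AddCommGroup V] [Module K V]
    (σ : Rep K (NSHecke cs K j) V) : Rep K (NSHecke cs K k) (K ⊗[K] V) :=
  tensorRep cs (Nat.sub_add_cancel hj) (epsPlusPow cs K (k - j)) σ

end Tensor

/-! ### The two-dimensional representations -/

section TwoDim

variable {W : Type} [Group W] {M : CoxeterMatrix (Fin 2)} (cs : CoxeterSystem M W)
variable (K : Type) [Field K] [Algebra Ground K]

/-- The quantum integer `[2] = u + u⁻¹` as an element of `K`. -/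
def qTwoK : K := algebraMap Ground K qTwo

/-- The matrices by which `P_1^{(k)}` and `P_2^{(k)}` act on `X^{(k)}(c)`. -/
def xMatrix (k : ℕ) (c : K) : Fin 2 → Matrix (Fin 2) (Fin 2) K :=
  ![!![qTwoK K ^ k, c; 0, 0], !![0, 0; 1, qTwoK K ^ k]]

variable {K}

/-- The representation `ρ` of `K H^{(k)}` on the space `K²` of column vectors is `X^{(k)}(c)`: the
generators `P_1^{(k)}`, `P_2^{(k)}` act by the matrices above. -/
def IsX {k : ℕ} (ρ : Rep K (NSHecke cs K k) (Fin 2 → K)) (c : K) : Prop :=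
  ∀ i, ρ (P cs K k i) = Matrix.toLin' (xMatrix K k c i)

variable (K)

/-- The constant `a^{(j)} = T_j(1 / [2])`, a value of the Chebyshev polynomial of the first kind. -/
def chebA (j : ℕ) : K := (Polynomial.Chebyshev.T K (j : ℤ)).eval (1 / qTwoK K)

end TwoDim

/-! ### The symmetric group on three letters -/

/-- The simple reflections `s₁ = (1 2)` and `s₂ = (2 3)` of the symmetric group on three letters. -/
def s3Simple (i : Fin 2) : Equiv.Perm (Fin 3) := Equiv.swap i.castSucc i.succ

/-- The homomorphism from the Coxeter group of type `A₂` to the symmetric group that maps simple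
reflections to simple reflections. -/
def s3Hom : (CoxeterMatrix.A 2).Group →* Equiv.Perm (Fin 3) :=
  (CoxeterMatrix.A 2).toCoxeterSystem.lift ⟨s3Simple, by
    unfold CoxeterMatrix.IsLiftable
    decide⟩

theorem s3Hom_simple (i : Fin 2) : s3Hom ((CoxeterMatrix.A 2).simple i) = s3Simple i :=
  (CoxeterMatrix.A 2).toCoxeterSystem.lift_apply_simple _ i

theorem s3_normal_form (w : (CoxeterMatrix.A 2).Group) :
    w ∈ [1, (CoxeterMatrix.A 2).simple 0, (CoxeterMatrix.A 2).simple 1,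
      (CoxeterMatrix.A 2).simple 0 * (CoxeterMatrix.A 2).simple 1,
      (CoxeterMatrix.A 2).simple 1 * (CoxeterMatrix.A 2).simple 0,
      (CoxeterMatrix.A 2).simple 0 * (CoxeterMatrix.A 2).simple 1 *
        (CoxeterMatrix.A 2).simple 0] := by
  have ha := (CoxeterMatrix.A 2).toCoxeterSystem.simple_mul_simple_self 0
  have hb := (CoxeterMatrix.A 2).toCoxeterSystem.simple_mul_simple_self 1
  have hab := (CoxeterMatrix.A 2).toCoxeterSystem.simple_mul_simple_pow 0 1
  have hm : (CoxeterMatrix.A 2) 0 1 = 3 := by decide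
  rw [hm] at hab
  refine (CoxeterMatrix.A 2).toCoxeterSystem.simple_induction_left w (by simp) ?_
  rw [CoxeterMatrix.toCoxeterSystem_simple] at *
  generalize hsa : (CoxeterMatrix.A 2).simple 0 = a at *
  generalize hbb : (CoxeterMatrix.A 2).simple 1 = b at *
  have hbab : b * (a * (b * a)) = a * b := by
    have h1 : a * b * (a * b) * (a * b) = 1 := by rw [← hab, pow_three']
    have h2 : a * (b * (a * (b * (a * b)))) = 1 := by simpa [mul_assoc] using h1
    have ha' : a⁻¹ = a := inv_eq_of_mul_eq_one_left ha
    have hb' : b⁻¹ = b := inv_eq_of_mul_eq_one_left hb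
    have h3 : (b * (a * (b * a))) * b * a = 1 := by
      have := congrArg (fun z => a⁻¹ * z * a) h2
      simpa [mul_assoc] using this
    have h4 : b * (a * (b * a)) = (b * a)⁻¹ := by
      rw [eq_inv_iff_mul_eq_one, ← mul_assoc]
      exact h3
    rw [h4, mul_inv_rev, ha', hb']
  have haa : ∀ z, a * (a * z) = z := fun z => by rw [← mul_assoc, ha, one_mul]
  have hbb' : ∀ z, b * (b * z) = z := fun z => by rw [← mul_assoc, hb, one_mul]
  have hbab' : b * (a * b) = a * (b * a) := by
    have := congrArg (fun z => b * z) hbab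
    simp only [hbb'] at this
    exact this.symm
  intro w i hw
  have hi : i = 0 ∨ i = 1 := by fin_cases i <;> simp
  simp only [List.mem_cons, List.not_mem_nil, or_false] at hw ⊢
  rcases hi with rfl | rfl
  · rw [hsa]
    rcases hw with rfl | rfl | rfl | rfl | rfl | rfl <;> simp [mul_assoc, ha, haa]
  · rw [hbb]
    rcases hw with rfl | rfl | rfl | rfl | rfl | rfl <;>
      simp [mul_assoc, hb, hbb', hbab, hbab']

theorem s3Hom_bijective : Function.Bijective s3Hom := by
  constructor
  · intro v w h
    have hv := s3_normal_form v
    have hw := s3_normal_form w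
    simp only [List.mem_cons, List.not_mem_nil, or_false] at hv hw
    rcases hv with rfl | rfl | rfl | rfl | rfl | rfl <;>
      rcases hw with rfl | rfl | rfl | rfl | rfl | rfl <;>
      first
        | rfl
        | (exfalso; revert h; simp only [map_mul, map_one, s3Hom_simple]; decide)
  · have hs : ∀ p : Equiv.Perm (Fin 3), p = 1 ∨ p = s3Simple 0 ∨ p = s3Simple 1 ∨
        p = s3Simple 0 * s3Simple 1 ∨ p = s3Simple 1 * s3Simple 0 ∨
        p = s3Simple 0 * s3Simple 1 * s3Simple 0 := by decide
    intro p
    simp only [← s3Hom_simple, ← map_mul] at hs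
    rcases hs p with h | h | h | h | h | h
    · exact ⟨1, by rw [h, map_one]⟩
    all_goals exact ⟨_, h.symm⟩

/-- The symmetric group on three letters as a Coxeter system of type `A₂`, with simple reflections
`s₁ = (1 2)` and `s₂ = (2 3)`. -/
def s3 : CoxeterSystem (CoxeterMatrix.A 2) (Equiv.Perm (Fin 3)) :=
  ⟨(MulEquiv.ofBijective s3Hom s3Hom_bijective).symm⟩

theorem s3_simple (i : Fin 2) : s3.simple i = s3Simple i := s3Hom_simple i

end NonstandardHecke

end

/-!
# Irreducible representations of the nonstandard Hecke algebra of `S₃`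

Write `q = [2]`. The element `g_s = 2 C'_s - q` of the Hecke algebra has square `q²`, so it is `q` times
a reflection, and `2 P_s⁽ᵏ⁾ - qᵏ = g_s ⊗ ⋯ ⊗ g_s` (`tprod_refl`). Hence `K H⁽ᵏ⁾` is generated by two
idempotents `e₀`, `e₁` (`idem`), and it is a quotient of the group algebra of the infinite dihedral
group. Its element `e₀ e₁ + e₁ e₀ - e₀ - e₁ + 1` (`centralElt`) is central and determines a simple
module almost completely: if it acts by `t`, then `e₀ e₁ e₀ = t e₀`, and the module is
two-dimensional with a basis `v = e₀ v`, `e₁ v`, unless `t` is `0` or `1`.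

**The possible values of `t`.** The rotation `g_0 g_1 / q²` of the Hecke algebra has the eigenvalues `1`,
`z`, `z⁻¹` (`refl_mul_refl_relation`), where `z = ζ²` and `(ζ + ζ⁻¹) / 2 = 1 / q`. In the `k`-fold tensor
power, with scalars extended to the algebraic closure, its `k`-th tensor power therefore has the
eigenvalues `zᵐ`, `|m| ≤ k`, on a decomposition of `1` into simultaneous eigenvectors
(`eq_zero_of_forall_eigen`). Since `zʲ + z⁻ʲ = 4 T_j(1 / q)² - 2`, the central element is annihilated by
`∏_{j ≤ k} (X - T_j(1 / q)²)` (`aeval_centralElt`), so that `t = T_j(1 / q)²` for some `j ≤ k`. The value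
`j = 0` gives `t = 1` and the two characters, the other values give the two-dimensional modules
(`equiv_character_or_exists_eigenvector`).

**Existence.** In a basis of eigenvectors of `g_0 g_1`, the two-dimensional representation of the
Hecke algebra maps `g_0` and `g_1` to monomial matrices. The entrywise product of matrices is
multiplicative on these, so it defines a two-dimensional representation of the nonstandard Hecke
algebra on the span of the two pure powers `v₊ ⊗ ⋯ ⊗ v₊` and `v₋ ⊗ ⋯ ⊗ v₋` (`hadamard_mul`). It lives
over the algebraic closure, but in a suitable basis the generators act by matrices over `K`
(`exists_twoDim`). The sign character is the restriction of `ε₋ ⊗ ε₊ ⊗ ⋯ ⊗ ε₊`.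

**Distinctness.** The numbers `T_j(1 / q)²`, `j ≥ 0`, are distinct and not zero, as `1 / q` is
transcendental and the Chebyshev polynomial `T_j` has degree `j`.
-/

namespace NonstandardHecke

/-! ### Transcendence of the quantum integer and Chebyshev values -/

/-- The hypothetical polynomial relation is specialised at the positive integers `u = n + 2`; the
values `u + u⁻¹` are pairwise distinct there. -/
theorem transcendental_qTwo : Transcendental ℤ qTwo := by
  rw [transcendental_iff]
  intro p hp
  have hroot : ∀ n : ℕ, (p.map (Int.castRingHom ℚ)).IsRoot (((n : ℚ) + 2) + ((n : ℚ) + 2)⁻¹) := by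
    intro n
    have hn : ((n : ℚ) + 2) ≠ 0 := by positivity
    let f : Ground →+* ℚ := LaurentPolynomial.eval₂ (Int.castRingHom ℚ) (Units.mk0 _ hn)
    have hf : f qTwo = ((n : ℚ) + 2) + ((n : ℚ) + 2)⁻¹ := by
      have h1 := LaurentPolynomial.eval₂_T_n (Int.castRingHom ℚ) (Units.mk0 _ hn) 1
      have h2 := LaurentPolynomial.eval₂_T_neg_n (Int.castRingHom ℚ) (Units.mk0 _ hn) 1
      simp only [Nat.cast_one, pow_one, Units.val_mk0, Units.val_inv_eq_inv_val] at h1 h2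
      simp only [qTwo, u, uInv, map_add, f, h1, h2]
    have h := congrArg f hp
    rw [map_zero, Polynomial.aeval_def, Polynomial.hom_eval₂, hf] at h
    rw [Polynomial.IsRoot.def, Polynomial.eval_map]
    rw [← h]
    congr 1
    exact RingHom.ext_int _ _
  have hinj : Function.Injective fun n : ℕ => ((n : ℚ) + 2) + ((n : ℚ) + 2)⁻¹ := by
    intro m n h
    have hm : ((m : ℚ) + 2) ≠ 0 := by positivity
    have hn : ((n : ℚ) + 2) ≠ 0 := by positivity
    have h1 : ((m : ℚ) - n) * (((m : ℚ) + 2) * (n + 2) - 1) = 0 := by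
      field_simp at h
      linear_combination h
    rcases mul_eq_zero.mp h1 with h2 | h2
    · exact_mod_cast sub_eq_zero.mp h2
    · have : (0 : ℚ) ≤ m * n + 2 * m + 2 * n := by positivity
      nlinarith
  have h0 : p.map (Int.castRingHom ℚ) = 0 :=
    Polynomial.eq_zero_of_infinite_isRoot _
      ((Set.infinite_range_of_injective hinj).mono (by rintro _ ⟨n, rfl⟩; exact hroot n))
  exact (Polynomial.map_eq_zero_iff (RingHom.injective_int _)).mp h0

section Scalars

variable (K : Type) [Field K] [Algebra Ground K]

theorem chebA_eq_aeval (j : ℕ) :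
    chebA K j = Polynomial.aeval (1 / qTwoK K) (Polynomial.Chebyshev.T ℤ (j : ℤ)) :=
  (Polynomial.Chebyshev.aeval_T _ _).symm

@[simp] theorem chebA_zero : chebA K 0 = 1 := by simp [chebA]

variable [IsFractionRing Ground K]

theorem charZero_of_isFractionRing : CharZero K := by
  have : CharZero Ground := charZero_of_injective_algebraMap (R := ℤ) (by
    intro m n h
    by_contra hmn
    have := (transcendental_iff.mp transcendental_qTwo) (Polynomial.C (m - n))
      (by rw [Polynomial.aeval_C, map_sub, h, sub_self])
    exact hmn (sub_eq_zero.mp (Polynomial.C_eq_zero.mp this)))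
  exact charZero_of_injective_algebraMap (IsFractionRing.injective Ground K)

theorem transcendental_one_div_qTwoK : Transcendental ℤ (1 / qTwoK K) := by
  intro h
  rw [one_div, IsAlgebraic.inv_iff] at h
  rw [qTwoK] at h
  exact transcendental_qTwo
    ((isAlgebraic_algebraMap_iff (IsFractionRing.injective Ground K)).mp h)

theorem qTwoK_ne_zero : qTwoK K ≠ 0 := by
  intro h
  apply transcendental_one_div_qTwoK K
  rw [h, div_zero]
  exact isAlgebraic_zero

theorem chebA_sq_injective {i j : ℕ} (h : chebA K i ^ 2 = chebA K j ^ 2) : i = j := by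
  rw [chebA_eq_aeval, chebA_eq_aeval, ← map_pow, ← map_pow] at h
  have h1 := transcendental_iff_injective.mp (transcendental_one_div_qTwoK K) h
  have h2 := congrArg Polynomial.natDegree h1
  simp only [Polynomial.natDegree_pow, Polynomial.Chebyshev.natDegree_T, Int.natAbs_natCast] at h2
  omega

theorem chebA_sq_ne_zero (j : ℕ) : chebA K j ^ 2 ≠ 0 := by
  rw [chebA_eq_aeval, ← map_pow]
  intro h
  have h1 := (transcendental_iff.mp (transcendental_one_div_qTwoK K)) _ h
  exact Polynomial.Chebyshev.T_ne_zero ℤ _ (pow_eq_zero_iff (two_ne_zero) |>.mp h1)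

theorem chebA_sq_ne_one {j : ℕ} (hj : 1 ≤ j) : chebA K j ^ 2 ≠ 1 := by
  intro h
  have := chebA_sq_injective K (i := j) (j := 0) (by rw [h, chebA_zero, one_pow])
  omega

end Scalars

/-- `T_j((ζ + ζ⁻¹) / 2) = (ζʲ + ζ⁻ʲ) / 2`. -/
theorem two_mul_eval_chebyshev {F : Type*} [Field F] {a ζ : F} (hζ : ζ ≠ 0)
    (ha : ζ + ζ⁻¹ = 2 * a) (j : ℕ) :
    2 * (Polynomial.Chebyshev.T F (j : ℤ)).eval a = ζ ^ j + ζ⁻¹ ^ j := by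
  induction j using Nat.twoStepInduction with
  | zero => simp; norm_num
  | one => simpa using ha.symm
  | more n h1 h2 =>
    push_cast at h2 ⊢
    rw [Polynomial.Chebyshev.T_add_two]
    simp only [Polynomial.eval_sub, Polynomial.eval_mul, Polynomial.eval_ofNat, Polynomial.eval_X]
    have : ζ * ζ⁻¹ = 1 := mul_inv_cancel₀ hζ
    linear_combination 2 * a * h2 - h1 - (ζ ^ (n + 1) + ζ⁻¹ ^ (n + 1)) * ha
      + (ζ ^ n + ζ⁻¹ ^ n) * this

/-! ### The Hecke algebra of the symmetric group on three letters -/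

/-- A reduced word for each permutation of three letters; the longest element gets `s₁ s₂ s₁`. -/
def s3Word (w : Equiv.Perm (Fin 3)) : List (Fin 2) :=
  if w = 1 then [] else if w = s3Simple 0 then [0] else if w = s3Simple 1 then [1]
  else if w = s3Simple 0 * s3Simple 1 then [0, 1]
  else if w = s3Simple 1 * s3Simple 0 then [1, 0] else [0, 1, 0]

theorem s3Word_prod : ∀ w, ((s3Word w).map s3Simple).prod = w := by decide

theorem s3Word_length_simple_mul :
    ∀ (i : Fin 2) (w : Equiv.Perm (Fin 3)),
      (s3Word (s3Simple i * w)).length ≤ (s3Word w).length + 1 := by decide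

theorem s3_length (w : Equiv.Perm (Fin 3)) : s3.length w = (s3Word w).length := by
  have hprod : ∀ ω : List (Fin 2), s3.wordProd ω = (ω.map s3Simple).prod := by
    intro ω
    rw [CoxeterSystem.wordProd, show s3.simple = s3Simple from funext s3_simple]
  have hle : ∀ ω : List (Fin 2), (s3Word (ω.map s3Simple).prod).length ≤ ω.length := by
    intro ω
    induction ω with
    | nil => decide
    | cons i ω ih =>
      rw [List.map_cons, List.prod_cons, List.length_cons]
      exact (s3Word_length_simple_mul i _).trans (Nat.add_le_add_right ih 1)
  apply le_antisymm
  · have := s3.length_wordProd_le (s3Word w)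
    rwa [hprod, s3Word_prod] at this
  · obtain ⟨ω, hω, rfl⟩ := s3.exists_isReduced w
    rw [hω.eq, hprod]
    exact hle ω

/-- Concatenating the chosen words of two elements whose lengths add gives the chosen word of the
product, up to the braid move `s₂ s₁ s₂ = s₁ s₂ s₁`. -/
theorem s3Word_mul : ∀ v w : Equiv.Perm (Fin 3),
    (s3Word (v * w)).length = (s3Word v).length + (s3Word w).length →
      s3Word (v * w) = s3Word v ++ s3Word w ∨
        (s3Word (v * w) = [0, 1, 0] ∧ s3Word v ++ s3Word w = [1, 0, 1]) := by
  decide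

theorem s3Word_simple : ∀ i, s3Word (s3Simple i) = [i] := by decide

section Lift

variable {S : Type*} [Ring S] [Algebra Ground S] (t : Fin 2 → S)
  (hquad : ∀ i, (t i - algebraMap Ground S u) * (t i + algebraMap Ground S uInv) = 0)
  (hbraid : t 0 * t 1 * t 0 = t 1 * t 0 * t 1)

/-- The homomorphism out of the Hecke algebra of `S₃` determined by the images of the two generators
`T_{s_i}`, which have to satisfy the quadratic relations and the braid relation. -/
noncomputable def heckeLift : HeckeAlgebra s3 →ₐ[Ground] S :=
  RingQuot.liftAlgHom Ground
    ⟨FreeAlgebra.lift Ground fun w => ((s3Word w).map t).prod, by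
      intro x y h
      induction h with
      | one => simp [s3Word]
      | mul v w h =>
        simp only [s3_length] at h
        simp only [map_mul, FreeAlgebra.lift_ι_apply]
        rw [← List.prod_append, ← List.map_append]
        rcases s3Word_mul v w h with h | ⟨h, h'⟩
        · rw [h]
        · rw [h, h']
          simpa [mul_assoc] using hbraid.symm
      | quadratic i =>
        rw [s3_simple]
        simpa [s3Word_simple] using hquad i⟩

theorem heckeLift_heckeT (i : Fin 2) :
    heckeLift t hquad hbraid (heckeT s3 (s3.simple i)) = t i := by
  unfold heckeLift heckeT
  erw [RingQuot.liftAlgHom_mkAlgHom_apply]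
  simp [s3_simple, s3Word_simple]

end Lift

/-! ### The elements `2 C'_s - [2]` -/

section Refl

variable {B W : Type} [Group W] {M : CoxeterMatrix B} (cs : CoxeterSystem M W)

/-- The element `g_s = 2 C'_s - [2] = [2] (p₊ - p₋)` of the Hecke algebra. Its square is `[2]²`, so
it is `[2]` times a reflection. -/
noncomputable def refl (i : B) : HeckeAlgebra cs := cPrime cs i + cSigned cs i

theorem u_mul_uInv : u * uInv = 1 := by
  rw [u, uInv, ← LaurentPolynomial.T_add]; simp

theorem heckeT_quadratic (i : B) :
    (heckeT cs (cs.simple i) - algebraMap Ground _ u) *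
      (heckeT cs (cs.simple i) + algebraMap Ground _ uInv) = 0 := by
  have := RingQuot.mkAlgHom_rel Ground (HeckeRel.quadratic (cs := cs) i)
  rw [map_mul, map_sub, map_add, AlgHom.commutes, AlgHom.commutes, map_zero] at this
  exact this

theorem heckeT_mul {v w : W} (h : cs.length (v * w) = cs.length v + cs.length w) :
    heckeT cs v * heckeT cs w = heckeT cs (v * w) := by
  have := RingQuot.mkAlgHom_rel Ground (HeckeRel.mul (cs := cs) v w h)
  rw [map_mul] at this
  exact this

theorem refl_mul_self (i : B) : refl cs i * refl cs i = qTwo ^ 2 • 1 := by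
  have h := heckeT_quadratic cs i
  simp only [refl, cPrime, cSigned, Algebra.algebraMap_eq_smul_one, qTwo, mul_add, add_mul, mul_sub,
    sub_mul, smul_mul_assoc, mul_smul_comm, one_mul, mul_one] at h ⊢
  linear_combination (norm := module) (4 : Ground) • h

/-- `2 P_s⁽ᵏ⁾ - [2]ᵏ = g_s ⊗ ⋯ ⊗ g_s`: expanding the right-hand side with
`g_s = [2] p₊ - [2] p₋` gives the difference of the even and of the odd terms. -/
theorem tprod_refl (k : ℕ) (i : B) :
    PiTensorProduct.tprod Ground (fun _ : Fin k => refl cs i) =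
      2 * powP cs k i - algebraMap Ground (HeckePow cs k) (qTwo ^ k) := by
  let ε : Bool → Ground := fun b => if b then 1 else -1
  have hs : refl cs i = ∑ b : Bool, ε b • signElt cs i b := by
    simp [refl, signElt, ε]
  have hε : ∀ a : Fin k → Bool, ∏ j, ε (a j) = if EvenSigns a then 1 else -1 := by
    intro a
    have h : ∏ j, ε (a j) = (-1) ^ (Finset.univ.filter fun i => a i = false).card := by
      simp [ε, Finset.prod_ite]
    rw [h]
    split_ifs with h'
    · exact Even.neg_one_pow h'
    · exact Odd.neg_one_pow (Nat.not_even_iff_odd.mp h')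
  have h2 : 2 * powP cs k i - algebraMap Ground (HeckePow cs k) (qTwo ^ k) =
      powP cs k i - powQ cs k i := by
    rw [powQ]; noncomm_ring
  rw [h2, powQ_eq, powP, hs]
  rw [MultilinearMap.map_sum (PiTensorProduct.tprod Ground
      (s := fun _ : Fin k => HeckeAlgebra cs)) (fun _ b => ε b • signElt cs i b)]
  rw [Finset.sum_filter, Finset.sum_filter, ← Finset.sum_sub_distrib]
  apply Finset.sum_congr rfl
  intro a _
  rw [MultilinearMap.map_smul_univ (PiTensorProduct.tprod Ground
      (s := fun _ : Fin k => HeckeAlgebra cs)) (fun j => ε (a j)) (fun j => signElt cs i (a j)), hε]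
  split_ifs <;> simp

end Refl

theorem heckeT_braid :
    heckeT s3 (s3.simple 0) * heckeT s3 (s3.simple 1) * heckeT s3 (s3.simple 0) =
      heckeT s3 (s3.simple 1) * heckeT s3 (s3.simple 0) * heckeT s3 (s3.simple 1) := by
  have key : ∀ a b : Fin 2, a ≠ b → heckeT s3 (s3.simple a) * heckeT s3 (s3.simple b) *
      heckeT s3 (s3.simple a) = heckeT s3 (s3.simple a * s3.simple b * s3.simple a) := by
    intro a b hab
    have h : ∀ a b : Fin 2, a ≠ b →
        (s3Word (s3Simple a * s3Simple b)).length =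
          (s3Word (s3Simple a)).length + (s3Word (s3Simple b)).length ∧
        (s3Word (s3Simple a * s3Simple b * s3Simple a)).length =
          (s3Word (s3Simple a * s3Simple b)).length + (s3Word (s3Simple a)).length := by
      decide
    rw [heckeT_mul, heckeT_mul]
    · simpa only [s3_length, s3_simple] using (h a b hab).2
    · simpa only [s3_length, s3_simple] using (h a b hab).1
  rw [key 0 1 (by decide), key 1 0 (by decide)]
  congr 1
  simp only [s3_simple]
  decide

/-- The braid relation in terms of the elements `g_s`. -/
theorem refl_braid :
    refl s3 0 * refl s3 1 * refl s3 0 - refl s3 1 * refl s3 0 * refl s3 1 =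
      (4 - qTwo ^ 2) • (refl s3 0 - refl s3 1) := by
  have h := heckeT_braid
  have h0 := heckeT_quadratic s3 0
  have h1 := heckeT_quadratic s3 1
  have hu := u_mul_uInv
  simp only [refl, cPrime, cSigned, Algebra.algebraMap_eq_smul_one, qTwo, mul_add, add_mul, mul_sub,
    sub_mul, smul_mul_assoc, mul_smul_comm, one_mul, mul_one] at h h0 h1 ⊢
  linear_combination (norm := module) (8 : Ground) • h - (4 * (u - uInv)) • (h0 - h1) +
    ((8 : Ground) • hu) • (heckeT s3 (s3.simple 0) - heckeT s3 (s3.simple 1))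

/-- With `x = g_0 g_1` and `y = g_1 g_0`, the eigenvalues of `x / [2]²` are `1` (in the
one-dimensional representations of the Hecke algebra) and the two numbers `z`, `z⁻¹` with sum
`4 / [2]² - 2` (in the two-dimensional one). -/
theorem refl_mul_refl_relation :
    (refl s3 0 * refl s3 1 - qTwo ^ 2 • 1) *
      (refl s3 0 * refl s3 1 + refl s3 1 * refl s3 0 - (4 - 2 * qTwo ^ 2) • 1) = 0 := by
  have h := congrArg (· * refl s3 1) refl_braid
  have h0 := refl_mul_self s3 0
  have h1 := refl_mul_self s3 1
  have h1' : ∀ z, z * refl s3 1 * refl s3 1 = qTwo ^ 2 • z := fun z => by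
    rw [mul_assoc, h1, mul_smul_comm, mul_one]
  simp only [sub_mul, mul_sub, mul_add, ← mul_assoc, smul_mul_assoc, mul_smul_comm, one_mul, mul_one,
    h0, h1, h1', smul_smul, smul_sub] at h ⊢
  linear_combination (norm := module) h

/-! ### Simultaneous eigenvectors for left multiplication -/

section Eigen

variable {L S : Type*} [Field L] [Ring S] [Algebra L S]

theorem aeval_mul_of_eigen {D X : S} {c : L} (h : D * X = c • X) (p : Polynomial L) :
    Polynomial.aeval D p * X = p.eval c • X := by
  induction p using Polynomial.induction_on' with
  | add p q hp hq => rw [map_add, add_mul, hp, hq, Polynomial.eval_add, add_smul]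
  | monomial n a =>
    have hn : D ^ n * X = c ^ n • X := by
      induction n with
      | zero => simp
      | succ n ih => rw [pow_succ, mul_assoc, h, mul_smul_comm, ih, smul_smul, pow_succ']
    rw [Polynomial.aeval_monomial, Polynomial.eval_monomial, mul_assoc, hn, ← Algebra.smul_def,
      smul_smul]

/-- Lagrange interpolation at three points: if `(w - a) (w - b) (w - c) = 0`, then `1` is the sum of
three eigenvectors of `w` that are polynomials in `w`. -/
theorem exists_eigen_decomposition {a b c : L} (hab : a ≠ b) (hac : a ≠ c) (hbc : b ≠ c) {w : S}
    (h : (w - a • 1) * (w - b • 1) * (w - c • 1) = 0) :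
    ∃ A B C : S, A + B + C = 1 ∧ w * A = a • A ∧ w * B = b • B ∧ w * C = c • C ∧
      ∀ v, Commute v w → Commute v A ∧ Commute v B ∧ Commute v C := by
  have hab' := sub_ne_zero.mpr hab
  have hac' := sub_ne_zero.mpr hac
  have hbc' := sub_ne_zero.mpr hbc
  have hcomm : ∀ v, Commute v w → ∀ (d e f : L),
      Commute v (d • ((w - e • 1) * (w - f • 1))) := by
    intro v hv d e f
    have h1 : ∀ e : L, Commute v (w - e • 1) := fun e =>
      hv.sub_right ((Commute.one_right v).smul_right e)
    exact ((h1 e).mul_right (h1 f)).smul_right d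
  simp only [sub_mul, mul_sub, smul_mul_assoc, mul_smul_comm, one_mul, mul_one] at h hcomm
  refine ⟨((a - b) * (a - c))⁻¹ • ((w - b • 1) * (w - c • 1)),
    (-((a - b) * (b - c)))⁻¹ • ((w - a • 1) * (w - c • 1)),
    ((a - c) * (b - c))⁻¹ • ((w - a • 1) * (w - b • 1)), ?_, ?_, ?_, ?_, ?_⟩
  · simp only [sub_mul, mul_sub, smul_mul_assoc, mul_smul_comm, one_mul, mul_one]
    match_scalars <;> field_simp <;> ring
  · rw [mul_smul_comm, smul_comm a]
    congr 1
    simp only [sub_mul, mul_sub, smul_mul_assoc, mul_smul_comm, one_mul, mul_one, ← mul_assoc] at h ⊢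
    linear_combination (norm := module) h
  · rw [mul_smul_comm, smul_comm b]
    congr 1
    simp only [sub_mul, mul_sub, smul_mul_assoc, mul_smul_comm, one_mul, mul_one, ← mul_assoc] at h ⊢
    linear_combination (norm := module) h
  · rw [mul_smul_comm, smul_comm c]
    congr 1
    simp only [sub_mul, mul_sub, smul_mul_assoc, mul_smul_comm, one_mul, mul_one, ← mul_assoc] at h ⊢
    linear_combination (norm := module) h
  · intro v hv
    simp only [sub_mul, mul_sub, smul_mul_assoc, mul_smul_comm, one_mul, mul_one]
    exact ⟨hcomm v hv _ _ _, hcomm v hv _ _ _, hcomm v hv _ _ _⟩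

/-- If commuting elements `w i` are diagonalisable with eigenvalues `1`, `z`, `z⁻¹`, an element that
annihilates all their simultaneous eigenvectors is zero. -/
theorem eq_zero_of_forall_eigen {ι : Type*} [Finite ι] {z : L} (hz : z ≠ 1) (hz' : z ≠ z⁻¹)
    (w : ι → S) (hw : ∀ i j, Commute (w i) (w j))
    (hrel : ∀ i, (w i - (1 : L) • 1) * (w i - z • 1) * (w i - z⁻¹ • 1) = 0) (c : S)
    (hc : ∀ (X : S) (m : ι → ℤ), (∀ i, |m i| ≤ 1) → (∀ i, w i * X = z ^ m i • X) → c * X = 0) :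
    c = 0 := by
  classical
  cases nonempty_fintype ι
  -- the set `s` holds the indices for which `X` is not yet known to be an eigenvector
  have key : ∀ (s : Finset ι) (X : S),
      (∀ i ∉ s, ∃ m : ℤ, |m| ≤ 1 ∧ w i * X = z ^ m • X) → c * X = 0 := by
    intro s
    induction s using Finset.induction_on with
    | empty =>
      intro X hX
      choose m hm hm' using fun i => hX i (Finset.notMem_empty i)
      exact hc X m hm hm'
    | insert a s _ ih =>
      intro X hX
      obtain ⟨A, B, C, h1, hA, hB, hC, hcomm⟩ := exists_eigen_decomposition (L := L) hz.symm
        (fun h => hz (inv_eq_one.mp h.symm)) hz' (hrel a)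
      have aux : ∀ (Y : S) (m₀ : ℤ), |m₀| ≤ 1 → w a * Y = z ^ m₀ • Y →
          (∀ i, Commute (w i) Y) → c * (Y * X) = 0 := by
        intro Y m₀ hm₀ hY hYc
        apply ih
        intro i hi
        by_cases hia : i = a
        · subst hia
          exact ⟨m₀, hm₀, by rw [← mul_assoc, hY, smul_mul_assoc]⟩
        · obtain ⟨m, hm, hm'⟩ := hX i (by simp [hia, hi])
          exact ⟨m, hm, by rw [← mul_assoc, (hYc i).eq, mul_assoc, hm', mul_smul_comm]⟩
      have hA' := aux A 0 (by simp) (by simpa using hA) fun i => (hcomm _ (hw i a)).1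
      have hB' := aux B 1 (by simp) (by simpa using hB) fun i => (hcomm _ (hw i a)).2.1
      have hC' := aux C (-1) (by simp) (by simpa using hC) fun i => (hcomm _ (hw i a)).2.2
      calc c * X = c * ((A + B + C) * X) := by rw [h1, one_mul]
        _ = 0 := by rw [add_mul, add_mul, mul_add, mul_add, hA', hB', hC', add_zero, add_zero]
  simpa using key Finset.univ 1 (by simp)

theorem map_const_mul_of_eigen {ι H : Type*} [Fintype ι] [DecidableEq ι] [Monoid H]
    (ψ : (ι → H) →* S) (x : H) (c : ι → L) (X : S)
    (h : ∀ i, ψ (Pi.mulSingle i x) * X = c i • X) :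
    ψ (fun _ => x) * X = (∏ i, c i) • X := by
  have key : ∀ s : Finset ι, ψ (s.piecewise (fun _ => x) 1) * X = (∏ i ∈ s, c i) • X := by
    intro s
    induction s using Finset.induction_on with
    | empty => simp
    | insert a s ha ih =>
      have hs : (insert a s).piecewise (fun _ => x) (1 : ι → H) =
          s.piecewise (fun _ => x) 1 * Pi.mulSingle a x := by
        funext i
        by_cases hi : i = a
        · subst hi; simp [ha]
        · simp [Finset.piecewise, hi]
      rw [hs, map_mul, mul_assoc, h, mul_smul_comm, ih, smul_smul, Finset.prod_insert ha]
  simpa using key Finset.univ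

end Eigen

/-! ### The polynomial relation in the nonstandard Hecke algebra -/

section Relation

variable {L S : Type*} [Field L] [Ring S] [Algebra L S] {k : ℕ}

/-- Under the diagonal map, `x = g_0 g_1` is diagonalisable at each tensor position with eigenvalues
`[2]²`, `[2]² z`, `[2]² z⁻¹`, so `x ⊗ ⋯ ⊗ x` has the eigenvalues `[2]²ᵏ zᵐ`, `|m| ≤ k`, and the
inverse of `x` up to a scalar, `g_1 g_0`, contributes `[2]²ᵏ z⁻ᵐ` on the same eigenvectors. -/
theorem aeval_eq_zero_of_tprod (α : HeckePow s3 k →+* S) (θ : Ground →+* L)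
    (hα : ∀ c, α (algebraMap Ground _ c) = algebraMap L S (θ c)) {q z : L} (hq : θ qTwo = q)
    (hq0 : q ≠ 0) (hz0 : z ≠ 0) (hz : z ≠ 1) (hz' : z ≠ z⁻¹)
    (hzq : q ^ 2 * (z + z⁻¹) = 4 - 2 * q ^ 2) (h4 : (4 : L) ≠ 0) {Z : S}
    (hZ : (4 * q ^ (2 * k)) • Z =
      α (PiTensorProduct.tprod Ground fun _ => refl s3 0 * refl s3 1) +
        α (PiTensorProduct.tprod Ground fun _ => refl s3 1 * refl s3 0) + (2 * q ^ (2 * k)) • 1)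
    {p : Polynomial L} {t : ℕ → L} (ht : ∀ j, 4 * t j = z ^ j + z⁻¹ ^ j + 2)
    (hp : ∀ j ≤ k, p.eval (t j) = 0) : Polynomial.aeval Z p = 0 := by
  set x := refl s3 0 * refl s3 1 with hx
  set y := refl s3 1 * refl s3 0 with hy
  have hαs : ∀ (c : Ground) (a : HeckePow s3 k), α (c • a) = θ c • α a := fun c a => by
    rw [Algebra.smul_def, map_mul, hα, ← Algebra.smul_def]
  let ψ : (Fin k → HeckeAlgebra s3) →* S :=
    (α : HeckePow s3 k →* S).comp (PiTensorProduct.tprodMonoidHom Ground)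
  let β : Fin k → HeckeAlgebra s3 →+* S := fun i =>
    α.comp (PiTensorProduct.singleAlgHom (R := Ground)
      (A := fun _ : Fin k => HeckeAlgebra s3) i : HeckeAlgebra s3 →ₐ[Ground] _).toRingHom
  have hβψ : ∀ i a, ψ (Pi.mulSingle i a) = β i a := fun i a => rfl
  have hβs : ∀ i (c : Ground) (a : HeckeAlgebra s3), β i (c • a) = θ c • β i a := fun i c a => by
    exact (congrArg α (map_smul (PiTensorProduct.singleAlgHom (R := Ground)
      (A := fun _ : Fin k => HeckeAlgebra s3) i) c a)).trans (hαs c _)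
  have hyx : y * x = qTwo ^ 4 • 1 := by
    rw [hx, hy, ← mul_assoc, mul_assoc (refl s3 1), refl_mul_self, mul_smul_comm, mul_one,
      smul_mul_assoc, refl_mul_self, smul_smul, ← pow_add]
  have hrel := refl_mul_refl_relation
  rw [← hx, ← hy] at hrel
  have hβyx : ∀ i, β i y * β i x = q ^ 4 • 1 := fun i => by
    rw [← map_mul, hyx, hβs, map_one, map_pow, hq]
  have hβrel : ∀ i, (β i x - q ^ 2 • 1) * (β i x + β i y - (4 - 2 * q ^ 2) • 1) = 0 := fun i => by
    have := congrArg (β i) hrel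
    simpa only [map_mul, map_sub, map_add, hβs, map_one, map_zero, map_pow, hq, map_ofNat] using this
  apply eq_zero_of_forall_eigen (L := L) hz hz' (fun i => (q ^ 2)⁻¹ • β i x)
  · intro i j
    refine Commute.smul_left (Commute.smul_right ?_ _) _
    by_cases hij : i = j
    · rw [hij]
    · rw [← hβψ, ← hβψ]
      exact (Pi.mulSingle_commute hij x x).map ψ
  · intro i
    have h := congrArg (· * β i x) (hβrel i)
    have h1 := hβyx i
    simp only [zero_mul, mul_assoc] at h
    simp only [sub_mul, add_mul, h1, mul_sub, mul_add, smul_mul_assoc, mul_smul_comm, one_mul,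
      mul_one] at h ⊢
    rw [← hzq] at h
    simp only [← mul_assoc] at h ⊢
    linear_combination (norm := skip) (q⁻¹ ^ 6) • h
    match_scalars <;> field_simp <;> ring
  · intro X m hm hX
    have hxX : ∀ i, β i x * X = (q ^ 2 * z ^ m i) • X := fun i => by
      have := congrArg (fun Y => q ^ 2 • Y) (hX i)
      simp only [smul_mul_assoc, smul_smul] at this
      rwa [mul_inv_cancel₀ (pow_ne_zero 2 hq0), one_smul] at this
    have hyX : ∀ i, β i y * X = (q ^ 2 * z ^ (-m i)) • X := fun i => by
      have h1 := congrArg (fun Y => (q ^ 2 * z ^ m i)⁻¹ • (β i y * Y)) (hxX i)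
      simp only [← mul_assoc, hβyx, smul_mul_assoc, one_mul, mul_smul_comm, smul_smul] at h1
      rw [mul_assoc _ (q ^ 2) (z ^ m i),
        inv_mul_cancel₀ (mul_ne_zero (pow_ne_zero 2 hq0) (zpow_ne_zero _ hz0)), one_smul] at h1
      rw [← h1, zpow_neg]
      congr 1
      field_simp
    have hprod : ∀ m' : Fin k → ℤ, ∏ i, (q ^ 2 * z ^ m' i) = q ^ (2 * k) * z ^ (∑ i, m' i) := by
      intro m'
      rw [Finset.prod_mul_distrib, Finset.prod_const, Finset.card_univ, Fintype.card_fin, ← pow_mul]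
      congr 1
      induction (Finset.univ : Finset (Fin k)) using Finset.induction_on with
      | empty => simp
      | insert a s ha ih => rw [Finset.prod_insert ha, Finset.sum_insert ha, zpow_add₀ hz0, ih]
    have h1 := map_const_mul_of_eigen ψ x _ X hxX
    have h2 := map_const_mul_of_eigen ψ y _ X hyX
    rw [hprod] at h1 h2
    rw [Finset.sum_neg_distrib] at h2
    have hM : (∑ i, m i).natAbs ≤ k := by
      have : |∑ i, m i| ≤ k := by
        calc |∑ i, m i| ≤ ∑ i, |m i| := Finset.abs_sum_le_sum_abs _ _
          _ ≤ ∑ _i : Fin k, 1 := Finset.sum_le_sum fun i _ => hm i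
          _ = k := by simp
      rwa [Int.abs_eq_natAbs, Nat.cast_le] at this
    generalize ∑ i, m i = M at h1 h2 hM
    have hzM : z ^ M + z ^ (-M) = z ^ M.natAbs + z⁻¹ ^ M.natAbs := by
      rcases Int.natAbs_eq M with h | h
      · conv_lhs => rw [h]
        rw [zpow_neg, zpow_natCast, inv_pow]
      · conv_lhs => rw [h]
        rw [neg_neg, zpow_neg, zpow_natCast, inv_pow, add_comm]
    have hZX : Z * X = t M.natAbs • X := by
      have h3 := congrArg (· * X) hZ
      simp only [add_mul, smul_mul_assoc, one_mul] at h3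
      have h1' : α (PiTensorProduct.tprod Ground fun _ => x) * X = _ := h1
      have h2' : α (PiTensorProduct.tprod Ground fun _ => y) * X = _ := h2
      have h4' : q ^ (2 * k) * z ^ M + q ^ (2 * k) * z ^ (-M) + 2 * q ^ (2 * k) =
          4 * q ^ (2 * k) * t M.natAbs := by
        linear_combination q ^ (2 * k) * hzM - q ^ (2 * k) * ht M.natAbs
      rw [h1', h2', ← add_smul, ← add_smul, h4', mul_smul _ (t M.natAbs)] at h3
      exact smul_right_injective S (mul_ne_zero h4 (pow_ne_zero _ hq0)) h3
    rw [aeval_mul_of_eigen hZX, hp _ hM, zero_smul]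

end Relation

/-! ### The idempotents generating the nonstandard Hecke algebra -/

section Field

variable (K : Type) [Field K] [Algebra Ground K]

/-- The idempotent `[2]⁻ᵏ P_i⁽ᵏ⁾` of the nonstandard Hecke algebra. -/
noncomputable def idem (k : ℕ) (i : Fin 2) : NSHecke s3 K k := (qTwoK K ^ k)⁻¹ • P s3 K k i

/-- The central element `e₀ e₁ + e₁ e₀ - e₀ - e₁ + 1`, where `e₀` and `e₁` are the idempotents
`[2]⁻ᵏ P_i⁽ᵏ⁾`. -/
noncomputable def centralElt (k : ℕ) : NSHecke s3 K k :=
  idem K k 0 * idem K k 1 + idem K k 1 * idem K k 0 - idem K k 0 - idem K k 1 + 1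

/-- The `k`-th tensor power of the Hecke algebra, with scalars extended to the algebraic closure
of `K`. The extension is made in two steps, so that it is visibly faithfully flat over the extension
to `K`. -/
def ClosurePow (k : ℕ) : Type := AlgebraicClosure K ⊗[K] (K ⊗[Ground] HeckePow s3 k)

noncomputable instance (k : ℕ) : Ring (ClosurePow K k) :=
  inferInstanceAs (Ring (AlgebraicClosure K ⊗[K] (K ⊗[Ground] HeckePow s3 k)))

noncomputable instance (k : ℕ) : Algebra (AlgebraicClosure K) (ClosurePow K k) :=
  inferInstanceAs (Algebra (AlgebraicClosure K)
    (AlgebraicClosure K ⊗[K] (K ⊗[Ground] HeckePow s3 k)))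

noncomputable instance (k : ℕ) : Algebra K (ClosurePow K k) :=
  inferInstanceAs (Algebra K (AlgebraicClosure K ⊗[K] (K ⊗[Ground] HeckePow s3 k)))

instance (k : ℕ) : IsScalarTower K (AlgebraicClosure K) (ClosurePow K k) :=
  inferInstanceAs (IsScalarTower K (AlgebraicClosure K)
    (AlgebraicClosure K ⊗[K] (K ⊗[Ground] HeckePow s3 k)))

/-- The embedding of `K H⁽ᵏ⁾` into the `k`-th tensor power of the Hecke algebra, with scalars extended
to the algebraic closure of `K`. -/
noncomputable def closureIncl (k : ℕ) :
    NSHecke s3 K k →ₐ[K] ClosurePow K k :=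
  (Algebra.TensorProduct.includeRight (R := K) (A := AlgebraicClosure K)
    (B := K ⊗[Ground] HeckePow s3 k)).comp (baseIncl s3 K k)

/-- The canonical map from the `k`-th tensor power of the Hecke algebra to its extension to the
algebraic closure of `K`. -/
noncomputable def powIncl (k : ℕ) :
    HeckePow s3 k →+* ClosurePow K k :=
  (Algebra.TensorProduct.includeRight (R := K) (A := AlgebraicClosure K)
    (B := K ⊗[Ground] HeckePow s3 k)).toRingHom.comp
    (Algebra.TensorProduct.includeRight (R := Ground) (A := K) (B := HeckePow s3 k)).toRingHom

theorem powIncl_algebraMap (k : ℕ) (c : Ground) :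
    powIncl K k (algebraMap Ground _ c) =
      algebraMap (AlgebraicClosure K) (ClosurePow K k)
        (((algebraMap K (AlgebraicClosure K)).comp (algebraMap Ground K)) c) := by
  have h1 : (Algebra.TensorProduct.includeRight (R := Ground) (A := K) (B := HeckePow s3 k))
      (algebraMap Ground _ c) = algebraMap K (K ⊗[Ground] HeckePow s3 k) (algebraMap Ground K c) := by
    rw [AlgHom.commutes]
    exact IsScalarTower.algebraMap_apply Ground K _ c
  have h2 : (Algebra.TensorProduct.includeRight (R := K) (A := AlgebraicClosure K)
      (B := K ⊗[Ground] HeckePow s3 k)) (algebraMap K _ (algebraMap Ground K c)) =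
      algebraMap K (ClosurePow K k) (algebraMap Ground K c) := AlgHom.commutes _ _
  rw [RingHom.comp_apply, ← IsScalarTower.algebraMap_apply K (AlgebraicClosure K)]
  exact (congrArg _ h1).trans h2

theorem two_smul_closureIncl_P (k : ℕ) (i : Fin 2) :
    (2 : K) • closureIncl K k (P s3 K k i) =
      powIncl K k (PiTensorProduct.tprod Ground fun _ => refl s3 i) + (qTwoK K ^ k) • 1 := by
  have h : closureIncl K k (P s3 K k i) = powIncl K k (powP s3 k i) := rfl
  have h2 : powIncl K k (2 * powP s3 k i) = (2 : K) • powIncl K k (powP s3 k i) := by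
    rw [two_mul, map_add, two_smul]
  rw [h, tprod_refl, map_sub, powIncl_algebraMap, h2, RingHom.comp_apply,
    ← IsScalarTower.algebraMap_apply K (AlgebraicClosure K), Algebra.algebraMap_eq_smul_one, map_pow]
  exact (sub_add_cancel _ _).symm

variable [IsFractionRing Ground K]

/-- A number `z = ζ²` with `(ζ + ζ⁻¹) / 2 = 1 / [2]` over the algebraic closure. -/
theorem exists_root_parameter : ∃ z : AlgebraicClosure K, z ≠ 0 ∧ z ≠ 1 ∧ z ≠ z⁻¹ ∧
    (algebraMap K (AlgebraicClosure K) (qTwoK K)) ^ 2 * (z + z⁻¹) =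
      4 - 2 * (algebraMap K (AlgebraicClosure K) (qTwoK K)) ^ 2 ∧
    ∀ j : ℕ, 4 * algebraMap K (AlgebraicClosure K) (chebA K j ^ 2) = z ^ j + z⁻¹ ^ j + 2 := by
  have := charZero_of_isFractionRing K
  set φ := algebraMap K (AlgebraicClosure K) with hφ
  have hq : φ (qTwoK K) ≠ 0 := by simpa using qTwoK_ne_zero K
  obtain ⟨s, hs⟩ := IsAlgClosed.exists_eq_mul_self (φ (1 / qTwoK K) ^ 2 - 1)
  set a := φ (1 / qTwoK K) with ha
  have haq : a * φ (qTwoK K) = 1 := by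
    rw [ha, ← map_mul, one_div_mul_cancel (qTwoK_ne_zero K), map_one]
  have hprod : (a + s) * (a - s) = 1 := by linear_combination hs
  have h0 : a + s ≠ 0 := left_ne_zero_of_mul_eq_one hprod
  have hinv : (a + s)⁻¹ = a - s := inv_eq_of_mul_eq_one_right hprod
  have hcheb : ∀ j : ℕ, 4 * φ (chebA K j ^ 2) =
      ((a + s) ^ 2) ^ j + ((a + s) ^ 2)⁻¹ ^ j + 2 := by
    intro j
    have h1 := two_mul_eval_chebyshev h0 (a := a) (by rw [hinv]; ring) j
    have h2 : φ (chebA K j) = (Polynomial.Chebyshev.T _ (j : ℤ)).eval a :=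
      Polynomial.Chebyshev.algebraMap_eval_T _ _
    have h3 : (a + s) ^ j * (a + s)⁻¹ ^ j = 1 := by rw [← mul_pow, mul_inv_cancel₀ h0, one_pow]
    have h4 : ((a + s) ^ 2) ^ j = ((a + s) ^ j) ^ 2 := pow_right_comm _ _ _
    have h5 : ((a + s) ^ 2)⁻¹ ^ j = ((a + s)⁻¹ ^ j) ^ 2 := by rw [← inv_pow, pow_right_comm]
    rw [map_pow, h2, h4, h5]
    linear_combination (2 * (Polynomial.Chebyshev.T _ (j : ℤ)).eval a +
      (a + s) ^ j + (a + s)⁻¹ ^ j) * h1 + 2 * h3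
  have hc1 : 4 * a ^ 2 = (a + s) ^ 2 + ((a + s) ^ 2)⁻¹ + 2 := by
    have := hcheb 1
    rw [map_pow, show φ (chebA K 1) = a by simp [chebA, ha]] at this
    simpa using this
  have hne : (a + s) ^ 2 ≠ ((a + s) ^ 2)⁻¹ := by
    intro h
    have hsq : (a + s) ^ 2 * (a + s) ^ 2 = 1 := by
      conv_lhs => rw [h]
      rw [← h, mul_comm]
      nth_rewrite 2 [h]
      exact mul_inv_cancel₀ (pow_ne_zero 2 h0)
    have ha1 : φ (chebA K 1 ^ 2) = a ^ 2 := by rw [map_pow]; simp [chebA, ha]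
    rw [← h] at hc1
    rcases mul_self_eq_one_iff.mp hsq with h1 | h1
    · apply chebA_sq_ne_one K le_rfl
      apply φ.injective
      rw [ha1, map_one]
      rw [h1] at hc1
      linear_combination hc1 / 4
    · apply chebA_sq_ne_zero K 1
      apply φ.injective
      rw [ha1, map_zero]
      rw [h1] at hc1
      linear_combination hc1 / 4
  refine ⟨(a + s) ^ 2, pow_ne_zero 2 h0, ?_, hne, ?_, hcheb⟩
  · intro h
    rw [h, inv_one] at hne
    exact hne rfl
  · linear_combination (-φ (qTwoK K) ^ 2) * hc1 + 4 * (a * φ (qTwoK K) + 1) * haq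

theorem closureIncl_injective (k : ℕ) : Function.Injective (closureIncl K k) :=
  (Algebra.TensorProduct.includeRight_injective (R := K) (A := AlgebraicClosure K)
    (B := K ⊗[Ground] HeckePow s3 k) (algebraMap K (AlgebraicClosure K)).injective).comp
    (baseIncl_injective s3 K k)

theorem idem_mul_self (k : ℕ) (i : Fin 2) : idem K k i * idem K k i = idem K k i := by
  have := charZero_of_isFractionRing K
  have hq : qTwoK K ^ k ≠ 0 := pow_ne_zero _ (qTwoK_ne_zero K)
  have h2 : (2 : K) ≠ 0 := two_ne_zero
  apply closureIncl_injective K k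
  have hP : closureIncl K k (idem K k i) = (2 * qTwoK K ^ k)⁻¹ •
      (powIncl K k (PiTensorProduct.tprod Ground fun _ => refl s3 i) + (qTwoK K ^ k) • 1) := by
    rw [← two_smul_closureIncl_P, smul_smul, idem, map_smul]
    congr 1
    field_simp
  have hR : powIncl K k (PiTensorProduct.tprod Ground fun _ => refl s3 i) *
      powIncl K k (PiTensorProduct.tprod Ground fun _ => refl s3 i) = (qTwoK K ^ k) ^ 2 • 1 := by
    rw [← map_mul, PiTensorProduct.tprod_mul_tprod]
    have : ((fun _ => refl s3 i) * fun _ => refl s3 i : Fin k → HeckeAlgebra s3) =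
        fun _ => qTwo ^ 2 • 1 := funext fun _ => refl_mul_self s3 i
    rw [this, MultilinearMap.map_smul_univ (PiTensorProduct.tprod Ground
      (s := fun _ : Fin k => HeckeAlgebra s3)) (fun _ => qTwo ^ 2) (fun _ => 1)]
    simp only [Finset.prod_const, Finset.card_univ, Fintype.card_fin]
    have h1 : (PiTensorProduct.tprod Ground fun _ : Fin k => (1 : HeckeAlgebra s3)) = 1 := rfl
    rw [h1, ← Algebra.algebraMap_eq_smul_one, powIncl_algebraMap, RingHom.comp_apply,
      ← IsScalarTower.algebraMap_apply K (AlgebraicClosure K), Algebra.algebraMap_eq_smul_one,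
      map_pow, map_pow,
      pow_right_comm]
    rfl
  rw [map_mul, hP]
  simp only [smul_mul_assoc, mul_smul_comm, add_mul, mul_add, hR, one_mul, mul_one, smul_add,
    smul_smul]
  match_scalars <;> field_simp <;> ring

/-- The eigenvalues of the central element are `T_j(1 / [2])²`, `0 ≤ j ≤ k`. -/
theorem aeval_centralElt (k : ℕ) : Polynomial.aeval (centralElt K k)
    (∏ j ∈ Finset.range (k + 1), (Polynomial.X - Polynomial.C (chebA K j ^ 2))) = 0 := by
  have := charZero_of_isFractionRing K
  have hq : qTwoK K ≠ 0 := qTwoK_ne_zero K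
  have hqk : qTwoK K ^ k ≠ 0 := pow_ne_zero _ hq
  obtain ⟨z, hz0, hz1, hz2, hz3, hz4⟩ := exists_root_parameter K
  apply closureIncl_injective K k
  rw [map_zero, ← Polynomial.aeval_algHom_apply, ← Polynomial.aeval_map_algebraMap (AlgebraicClosure K)]
  refine aeval_eq_zero_of_tprod (powIncl K k) _ (powIncl_algebraMap K k) rfl
    ((map_ne_zero (algebraMap K (AlgebraicClosure K))).mpr hq) hz0 hz1 hz2 hz3 (by norm_num) ?_ hz4 ?_
  · have hxy : ∀ i j : Fin 2, powIncl K k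
        (PiTensorProduct.tprod Ground fun _ => refl s3 i * refl s3 j) =
        powIncl K k (PiTensorProduct.tprod Ground fun _ => refl s3 i) *
          powIncl K k (PiTensorProduct.tprod Ground fun _ => refl s3 j) := by
      intro i j
      rw [← map_mul, PiTensorProduct.tprod_mul_tprod]
      rfl
    have hP : ∀ i, powIncl K k (PiTensorProduct.tprod Ground fun _ => refl s3 i) =
        (2 * qTwoK K ^ k) • closureIncl K k (idem K k i) - (qTwoK K ^ k) • 1 := fun i => by
      rw [eq_sub_iff_add_eq, ← two_smul_closureIncl_P, idem, map_smul, smul_smul]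
      congr 1
      field_simp
    have hs : ∀ (c : K) (X : ClosurePow K k),
      (algebraMap K (AlgebraicClosure K) c) • X = c • X := fun c X => algebraMap_smul _ c X
    rw [hxy, hxy, hP, hP, centralElt]
    have e1 : ((4 : AlgebraicClosure K) *
        ((algebraMap K (AlgebraicClosure K)).comp (algebraMap Ground K) qTwo) ^ (2 * k)) =
        algebraMap K (AlgebraicClosure K) (4 * (qTwoK K ^ k) ^ 2) := by
      rw [RingHom.comp_apply, map_mul, map_ofNat, map_pow, map_pow, ← pow_mul, mul_comm k, qTwoK]
    have e2 : ((2 : AlgebraicClosure K) *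
        ((algebraMap K (AlgebraicClosure K)).comp (algebraMap Ground K) qTwo) ^ (2 * k)) =
        algebraMap K (AlgebraicClosure K) (2 * (qTwoK K ^ k) ^ 2) := by
      rw [RingHom.comp_apply, map_mul, map_ofNat, map_pow, map_pow, ← pow_mul, mul_comm k, qTwoK]
    rw [e1, e2, hs, hs]
    simp only [map_add, map_sub, map_mul, map_one, sub_mul, mul_sub, smul_mul_assoc,
      mul_smul_comm, one_mul, mul_one]
    module
  · intro j hj
    rw [Polynomial.eval_map_algebraMap, Polynomial.aeval_algebraMap_apply, Polynomial.coe_aeval_eq_eval,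
      Polynomial.eval_prod, Finset.prod_eq_zero (i := j) (by simpa [Nat.lt_succ_iff] using hj), map_zero]
    simp

end Field

/-! ### One-dimensional representations -/

theorem adjoin_range_genP (k : ℕ) :
    Algebra.adjoin Ground (Set.range (genP s3 k)) = ⊤ := by
  have := Algebra.adjoin_adjoin_coe_preimage (R := Ground) (s := Set.range (powP s3 k))
  refine Eq.trans ?_ this
  congr 1
  ext x
  simp only [Set.mem_range, Subtype.ext_iff]
  rfl

section OneDim

variable (K : Type) [Field K] [Algebra Ground K]

theorem adjoin_range_P (k : ℕ) : Algebra.adjoin K (Set.range (P s3 K k)) = ⊤ := by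
  have := Algebra.TensorProduct.adjoin_one_tmul_image_eq_top (A := K) (Set.range (genP s3 k))
    (adjoin_range_genP k)
  rw [← this, ← Set.range_comp]
  rfl

/-- The one-dimensional representation of `K H⁽ᵏ⁾` obtained from one of the tensor power of the
Hecke algebra. -/
noncomputable def nsChar {k : ℕ} (χ : HeckePow s3 k →ₐ[Ground] Ground) :
    NSHecke s3 K k →ₐ[K] K :=
  extendScalars Ground K ((Algebra.ofId Ground K).comp (χ.comp (nonstandardHecke s3 k).val))

theorem two_mul_nsChar_P {k : ℕ} (χ : HeckePow s3 k →ₐ[Ground] Ground) (i : Fin 2) :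
    2 * nsChar K χ (P s3 K k i) =
      algebraMap Ground K (χ (PiTensorProduct.tprod Ground fun _ => refl s3 i)) + qTwoK K ^ k := by
  have h : nsChar K χ (P s3 K k i) = algebraMap Ground K (χ (powP s3 k i)) :=
    extendScalars_tmul Ground K _ _
  have h2 : χ (2 * powP s3 k i) = 2 * χ (powP s3 k i) := by rw [two_mul, map_add, two_mul]
  rw [tprod_refl, map_sub, h2, AlgHom.commutes, h, map_sub, map_mul, map_ofNat]
  simp [qTwoK]

theorem heckeTrivial_refl (i : Fin 2) : heckeTrivial s3 (refl s3 i) = qTwo := by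
  rw [refl, cPrime, cSigned, map_add, map_add, map_sub, AlgHom.commutes, AlgHom.commutes,
    heckeTrivial_heckeT, s3.length_simple]
  simp only [Nat.cast_one, Algebra.algebraMap_self_apply, qTwo, ← u.eq_def]
  ring

/-- The sign representation `T_s ↦ -u⁻¹` of the Hecke algebra. -/
noncomputable def heckeSign : HeckeAlgebra s3 →ₐ[Ground] Ground :=
  heckeLift (fun _ => -uInv) (by simp) rfl

theorem heckeSign_refl (i : Fin 2) : heckeSign (refl s3 i) = -qTwo := by
  rw [refl, cPrime, cSigned, map_add, map_add, map_sub, AlgHom.commutes, AlgHom.commutes,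
    heckeSign, heckeLift_heckeT]
  simp only [Algebra.algebraMap_self_apply, qTwo]
  ring

/-- The tensor product of one-dimensional representations of the Hecke algebra. -/
noncomputable def charTensor {k : ℕ} (χ : Fin k → HeckeAlgebra s3 →ₐ[Ground] Ground) :
    HeckePow s3 k →ₐ[Ground] Ground :=
  PiTensorProduct.liftAlgHom
    ((MultilinearMap.mkPiAlgebra Ground (Fin k) Ground).compLinearMap
      fun j => (χ j).toLinearMap)
    (by simp) (by intro x y; simp [Finset.prod_mul_distrib])

theorem charTensor_tprod {k : ℕ} (χ : Fin k → HeckeAlgebra s3 →ₐ[Ground] Ground)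
    (x : Fin k → HeckeAlgebra s3) :
    charTensor χ (PiTensorProduct.tprod Ground x) = ∏ j, χ j (x j) := by
  refine (PiTensorProduct.lift.tprod _).trans ?_
  simp

variable [IsFractionRing Ground K]

theorem nsChar_heckePowTrivial_P (k : ℕ) (i : Fin 2) :
    nsChar K (heckePowTrivial s3 k) (P s3 K k i) = qTwoK K ^ k := by
  have := charZero_of_isFractionRing K
  have h := two_mul_nsChar_P K (heckePowTrivial s3 k) i
  have h1 : heckePowTrivial s3 k = charTensor fun _ => heckeTrivial s3 := rfl
  rw [h1, charTensor_tprod] at h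
  simp only [heckeTrivial_refl, Finset.prod_const, Finset.card_univ, Fintype.card_fin,
    map_pow] at h
  rw [← h1] at h
  change _ = qTwoK K ^ k + qTwoK K ^ k at h
  rw [← two_mul] at h
  exact mul_left_cancel₀ two_ne_zero h

/-- The sign representation of `K H⁽ᵏ⁾` is the restriction of `ε₋ ⊗ ε₊ ⊗ ⋯ ⊗ ε₊`: any odd number of
factors `ε₋` would do. -/
theorem exists_sign_character {k : ℕ} (hk : 1 ≤ k) :
    ∃ χ : NSHecke s3 K k →ₐ[K] K, ∀ i, χ (P s3 K k i) = 0 := by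
  have := charZero_of_isFractionRing K
  obtain ⟨n, rfl⟩ := Nat.exists_eq_add_of_le' hk
  refine ⟨nsChar K (charTensor (Fin.cons heckeSign fun _ => heckeTrivial s3)), fun i => ?_⟩
  have h := two_mul_nsChar_P K (charTensor (Fin.cons heckeSign fun _ : Fin n => heckeTrivial s3)) i
  rw [charTensor_tprod, Fin.prod_univ_succ] at h
  simp only [Fin.cons_zero, Fin.cons_succ, heckeTrivial_refl, heckeSign_refl, Finset.prod_const,
    Finset.card_univ, Fintype.card_fin, map_mul, map_pow, map_neg] at h
  change _ = -qTwoK K * qTwoK K ^ n + qTwoK K ^ (n + 1) at h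
  have h0 : -qTwoK K * qTwoK K ^ n + qTwoK K ^ (n + 1) = 0 := by ring
  rw [h0] at h
  exact (mul_eq_zero.mp h).resolve_left two_ne_zero

end OneDim

/-! ### Two-dimensional representations -/

section TwoDimRep

variable {L : Type} [Field L] [Algebra Ground L] {z : L}

/-- The image `[2] (0, b⁻¹; b, 0)` of `g_s` in the two-dimensional representation of the Hecke algebra,
in a basis of eigenvectors of `g_0 g_1`; here `b = 1` for the first generator and `b = z` for the
second. -/
noncomputable def reflMatrix (L : Type) [Field L] [Algebra Ground L] (z : L) (i : Fin 2) :
    Matrix (Fin 2) (Fin 2) L :=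
  !![0, algebraMap Ground L qTwo * (z ^ (i : ℕ))⁻¹; algebraMap Ground L qTwo * z ^ (i : ℕ), 0]

theorem matrix_fin_two_congr {R : Type*} {a b c d a' b' c' d' : R} (ha : a = a') (hb : b = b')
    (hc : c = c') (hd : d = d') : !![a, b; c, d] = !![a', b'; c', d'] := by
  rw [ha, hb, hc, hd]

theorem algebraMap_matrix_fin_two (c : Ground) : algebraMap Ground (Matrix (Fin 2) (Fin 2) L) c =
    !![algebraMap Ground L c, 0; 0, algebraMap Ground L c] := by
  ext a b
  fin_cases a <;> fin_cases b <;> simp [Matrix.algebraMap_matrix_apply]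

theorem exists_hecke_twoDim [CharZero L] (hz0 : z ≠ 0)
    (hz : (algebraMap Ground L qTwo) ^ 2 * (z + z⁻¹) = 4 - 2 * (algebraMap Ground L qTwo) ^ 2) :
    ∃ φ : HeckeAlgebra s3 →ₐ[Ground] Matrix (Fin 2) (Fin 2) L,
      ∀ i, φ (refl s3 i) = reflMatrix L z i := by
  set v := algebraMap Ground L u with hv
  set w := algebraMap Ground L uInv with hw
  have hvw : v * w = 1 := by rw [hv, hw, ← map_mul, u_mul_uInv, map_one]
  have hq : algebraMap Ground L qTwo = v + w := by rw [qTwo, map_add]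
  have hal := algebraMap_matrix_fin_two (L := L)
  rw [hq] at hz
  have hzz : z * z⁻¹ = 1 := mul_inv_cancel₀ hz0
  -- `T_s = (g_s + u - u⁻¹) / 2`
  let t : Fin 2 → Matrix (Fin 2) (Fin 2) L := fun i =>
    !![(v - w) / 2, (v + w) / 2 * (z ^ (i : ℕ))⁻¹; (v + w) / 2 * z ^ (i : ℕ), (v - w) / 2]
  have hquad : ∀ i, (t i - algebraMap Ground _ u) * (t i + algebraMap Ground _ uInv) = 0 := by
    intro i
    have hi : z ^ (i : ℕ) * (z ^ (i : ℕ))⁻¹ = 1 := mul_inv_cancel₀ (pow_ne_zero _ hz0)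
    have h0 : (0 : Matrix (Fin 2) (Fin 2) L) = !![0, 0; 0, 0] := by
      ext a b
      fin_cases a <;> fin_cases b <;> rfl
    rw [hal, hal, h0, ← hv, ← hw]
    simp only [t, Matrix.sub_cons, Matrix.add_cons, Matrix.of_sub_of,
      Matrix.of_add_of, Matrix.head_cons, Matrix.tail_cons, Matrix.empty_sub_empty,
      Matrix.empty_add_empty, Matrix.mul_fin_two]
    refine matrix_fin_two_congr ?_ ?_ ?_ ?_
    · linear_combination ((v + w) / 2) ^ 2 * hi
    · ring
    · ring
    · linear_combination ((v + w) / 2) ^ 2 * hi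
  have hbraid : t 0 * t 1 * t 0 = t 1 * t 0 * t 1 := by
    have e1 : ((v + w) / 2) ^ 2 * (z + z⁻¹) = 1 - 2 * ((v + w) / 2) ^ 2 := by
      linear_combination hz / 4
    have e2 : ((v - w) / 2) ^ 2 - ((v + w) / 2) ^ 2 + 1 = 0 := by linear_combination -hvw
    simp only [t, Matrix.mul_fin_two, Fin.val_zero, Fin.val_one, pow_zero, pow_one, inv_one, mul_one]
    generalize (v + w) / 2 = Q at *
    generalize (v - w) / 2 = H at *
    refine matrix_fin_two_congr ?_ ?_ ?_ ?_
    · linear_combination -H * Q ^ 2 * hzz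
    · linear_combination Q * (1 - z⁻¹) * e2 + Q * (1 - z⁻¹) * e1 + Q ^ 3 * hzz
    · linear_combination Q * (1 - z) * e2 + Q * (1 - z) * e1 + Q ^ 3 * hzz
    · linear_combination -H * Q ^ 2 * hzz
  refine ⟨heckeLift t hquad hbraid, fun i => ?_⟩
  rw [refl, cPrime, cSigned, map_add, map_add, map_sub, AlgHom.commutes, AlgHom.commutes,
    heckeLift_heckeT, hal, hal, reflMatrix, hq, ← hv, ← hw]
  simp only [t, Matrix.sub_cons, Matrix.add_cons, Matrix.of_sub_of,
    Matrix.of_add_of, Matrix.head_cons, Matrix.tail_cons, Matrix.empty_sub_empty,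
    Matrix.empty_add_empty]
  refine matrix_fin_two_congr ?_ ?_ ?_ ?_ <;> ring

/-! The entrywise product of `2 × 2` matrices gives a linear map from the tensor power of the Hecke
algebra to matrices. It is the compression of the representation on the tensor power of `L²` to the
span of the tensor powers of the two basis vectors. -/

section Hadamard

variable (φ : HeckeAlgebra s3 →ₐ[Ground] Matrix (Fin 2) (Fin 2) L) (j : ℕ)

/-- The entry of the entrywise product of the matrices `φ h_1, …, φ h_j`, as a linear function of
`h_1 ⊗ ⋯ ⊗ h_j`. -/
noncomputable def hadamardEntry (a b : Fin 2) : HeckePow s3 j →ₗ[Ground] L :=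
  PiTensorProduct.lift ((MultilinearMap.mkPiAlgebra Ground (Fin j) L).compLinearMap
    fun _ => (Matrix.entryLinearMap Ground L a b).comp φ.toLinearMap)

/-- The entrywise product of the matrices `φ h_1, …, φ h_j`, as a linear function of
`h_1 ⊗ ⋯ ⊗ h_j`. -/
noncomputable def hadamard : HeckePow s3 j →ₗ[Ground] Matrix (Fin 2) (Fin 2) L where
  toFun X := Matrix.of fun a b => hadamardEntry φ j a b X
  map_add' X Y := by ext a b; simp
  map_smul' c X := by ext a b; simp

theorem hadamard_tprod (h : Fin j → HeckeAlgebra s3) (a b : Fin 2) :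
    hadamard φ j (PiTensorProduct.tprod Ground h) a b = ∏ l, φ (h l) a b := by
  refine (PiTensorProduct.lift.tprod _).trans ?_
  simp

variable {φ j}

theorem hadamard_tprod_refl (hφ : ∀ i, φ (refl s3 i) = reflMatrix L z i) (hj : 1 ≤ j) (i : Fin 2) :
    hadamard φ j (PiTensorProduct.tprod Ground fun _ => refl s3 i) =
      !![0, algebraMap Ground L qTwo ^ j * (z ^ (i : ℕ))⁻¹ ^ j;
        algebraMap Ground L qTwo ^ j * (z ^ (i : ℕ)) ^ j, 0] := by
  have hj' : j ≠ 0 := by omega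
  ext a b
  rw [hadamard_tprod]
  fin_cases a <;> fin_cases b <;> simp [hφ, reflMatrix, hj', mul_pow]

/-- Since `φ g_s` is a monomial matrix, the entrywise product is multiplicative against
`g_s ⊗ ⋯ ⊗ g_s`. -/
theorem hadamard_mul_tprod_refl (hφ : ∀ i, φ (refl s3 i) = reflMatrix L z i) (hj : 1 ≤ j)
    (X : HeckePow s3 j) (i : Fin 2) :
    hadamard φ j (X * PiTensorProduct.tprod Ground fun _ => refl s3 i) =
      hadamard φ j X * hadamard φ j (PiTensorProduct.tprod Ground fun _ => refl s3 i) := by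
  induction X using PiTensorProduct.induction_on with
  | add X Y hX hY => rw [add_mul, map_add, hX, hY, map_add, add_mul]
  | smul_tprod r h =>
    rw [smul_mul_assoc, map_smul, map_smul, smul_mul_assoc, PiTensorProduct.tprod_mul_tprod]
    congr 1
    rw [hadamard_tprod_refl hφ hj]
    ext a b
    rw [hadamard_tprod, Matrix.mul_apply, Fin.sum_univ_two, hadamard_tprod, hadamard_tprod]
    simp only [Pi.mul_apply, map_mul, hφ, Matrix.mul_apply, Fin.sum_univ_two]
    fin_cases b <;> simp [reflMatrix, Finset.prod_mul_distrib, mul_pow]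

theorem hadamard_one (hj : 1 ≤ j) : hadamard φ j 1 = 1 := by
  have hj' : j ≠ 0 := by omega
  ext a b
  have h1 : (1 : HeckePow s3 j) = PiTensorProduct.tprod Ground fun _ => 1 := rfl
  rw [h1, hadamard_tprod]
  by_cases hab : a = b <;> simp [Matrix.one_apply, hab, hj']

variable [CharZero L]

theorem hadamard_powP (hφ : ∀ i, φ (refl s3 i) = reflMatrix L z i) (hj : 1 ≤ j) (i : Fin 2) :
    hadamard φ j (powP s3 j i) = !![algebraMap Ground L qTwo ^ j / 2,
        algebraMap Ground L qTwo ^ j / 2 * (z ^ (i : ℕ))⁻¹ ^ j;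
      algebraMap Ground L qTwo ^ j / 2 * (z ^ (i : ℕ)) ^ j, algebraMap Ground L qTwo ^ j / 2] := by
  have h := hadamard_tprod_refl hφ hj i
  rw [tprod_refl, map_sub, two_mul, map_add, Algebra.algebraMap_eq_smul_one, map_smul,
    hadamard_one hj, sub_eq_iff_eq_add, ← Algebra.algebraMap_eq_smul_one,
    algebraMap_matrix_fin_two, map_pow] at h
  rw [Matrix.eta_fin_two (hadamard φ j (powP s3 j i))]
  have h' := fun a b => congrFun (congrFun h a) b
  simp only [Matrix.add_apply] at h'
  refine matrix_fin_two_congr ?_ ?_ ?_ ?_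
  · have h3 : _ = 0 + algebraMap Ground L qTwo ^ j := h' 0 0
    linear_combination h3 / 2
  · have h3 : _ = algebraMap Ground L qTwo ^ j * (z ^ (i : ℕ))⁻¹ ^ j + 0 := h' 0 1
    linear_combination h3 / 2
  · have h3 : _ = algebraMap Ground L qTwo ^ j * (z ^ (i : ℕ)) ^ j + 0 := h' 1 0
    linear_combination h3 / 2
  · have h3 : _ = 0 + algebraMap Ground L qTwo ^ j := h' 1 1
    linear_combination h3 / 2

theorem hadamard_mul (hφ : ∀ i, φ (refl s3 i) = reflMatrix L z i) (hj : 1 ≤ j)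
    (X : HeckePow s3 j) {Y : HeckePow s3 j} (hY : Y ∈ nonstandardHecke s3 j) :
    hadamard φ j (X * Y) = hadamard φ j X * hadamard φ j Y := by
  induction hY using Algebra.adjoin_induction generalizing X with
  | mem Y hY =>
    obtain ⟨i, rfl⟩ := hY
    have h := hadamard_mul_tprod_refl hφ hj X i
    have h2 : hadamard φ j (X * powP s3 j i) + hadamard φ j (X * powP s3 j i) =
        hadamard φ j X * hadamard φ j (powP s3 j i) +
        hadamard φ j X * hadamard φ j (powP s3 j i) := by
      rw [tprod_refl, mul_sub, map_sub, map_sub, mul_sub, two_mul, mul_add, map_add, map_add,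
        mul_add, Algebra.algebraMap_eq_smul_one, mul_smul_comm, mul_one, map_smul, map_smul,
        hadamard_one hj, mul_smul_comm, mul_one] at h
      exact sub_left_injective h
    ext a b
    have h3 := congrFun (congrFun h2 a) b
    rw [Matrix.add_apply, Matrix.add_apply, ← two_mul, ← two_mul] at h3
    exact mul_left_cancel₀ two_ne_zero h3
  | algebraMap r =>
    rw [Algebra.algebraMap_eq_smul_one, mul_smul_comm, mul_one, map_smul, map_smul, hadamard_one hj,
      mul_smul_comm, mul_one]
  | add Y Z _ _ hY hZ => rw [mul_add, map_add, hY, hZ, map_add, mul_add]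
  | mul Y Z _ _ hY hZ => rw [← mul_assoc, hZ, hY, hZ Y, mul_assoc]

/-- The representation of the nonstandard Hecke algebra given by the entrywise product, in another
basis. -/
noncomputable def hadamardHom (hφ : ∀ i, φ (refl s3 i) = reflMatrix L z i) (hj : 1 ≤ j)
    {C C' : Matrix (Fin 2) (Fin 2) L} (hC : C * C' = 1) :
    nonstandardHecke s3 j →ₐ[Ground] Matrix (Fin 2) (Fin 2) L :=
  AlgHom.ofLinearMap
    ((LinearMap.mulLeft Ground C').comp
      ((LinearMap.mulRight Ground C).comp
        ((hadamard φ j).comp (nonstandardHecke s3 j).val.toLinearMap)))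
    (by simpa [hadamard_one hj] using mul_eq_one_comm.mp hC)
    (by
      rintro X ⟨Y, hY⟩
      have h := hadamard_mul hφ hj (X : HeckePow s3 j) hY
      simp only [LinearMap.comp_apply, AlgHom.toLinearMap_apply, map_mul, Subalgebra.coe_val, h,
        LinearMap.mulLeft_apply, LinearMap.mulRight_apply]
      calc C' * (hadamard φ j X * hadamard φ j Y * C) =
          C' * (hadamard φ j X * 1 * hadamard φ j Y * C) := by rw [mul_one]
        _ = _ := by rw [← hC]; simp only [mul_assoc])

theorem hadamardHom_genP (hφ : ∀ i, φ (refl s3 i) = reflMatrix L z i) (hj : 1 ≤ j)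
    {C C' : Matrix (Fin 2) (Fin 2) L} (hC : C * C' = 1) {i : Fin 2} {A : Matrix (Fin 2) (Fin 2) L}
    (h : hadamard φ j (powP s3 j i) * C = C * A) : hadamardHom hφ hj hC (genP s3 j i) = A := by
  change C' * (hadamard φ j (powP s3 j i) * C) = A
  rw [h, ← mul_assoc, mul_eq_one_comm.mp hC, one_mul]

end Hadamard

end TwoDimRep

/-- A homomorphism whose values on generators lift along an injective homomorphism `ι` lifts. -/
theorem exists_lift_of_adjoin {R N A B ι' : Type*} [CommRing R] [Ring N] [Algebra R N] [Ring A]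
    [Algebra R A] [Ring B] [Algebra R B] (ψ : N →ₐ[R] B) (ι : A →ₐ[R] B)
    (hι : Function.Injective ι) (g : ι' → N) (hg : Algebra.adjoin R (Set.range g) = ⊤) (f : ι' → A)
    (h : ∀ i, ψ (g i) = ι (f i)) : ∃ ρ : N →ₐ[R] A, ∀ i, ρ (g i) = f i := by
  have hmem : ∀ x, ψ x ∈ ι.range := by
    intro x
    have hle : Algebra.adjoin R (Set.range g) ≤ ι.range.comap ψ := by
      refine Algebra.adjoin_le ?_
      rintro _ ⟨i, rfl⟩
      exact ⟨f i, (h i).symm⟩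
    rw [hg] at hle
    exact hle (Algebra.mem_top (x := x))
  refine ⟨(AlgEquiv.ofInjective ι hι).symm.toAlgHom.comp (ψ.codRestrict _ hmem), fun i => hι ?_⟩
  rw [← h]
  exact congrArg Subtype.val ((AlgEquiv.ofInjective ι hι).apply_symm_apply ⟨ψ (g i), hmem _⟩)

section Descent

variable (K : Type) [Field K] [Algebra Ground K] [IsFractionRing Ground K]

/-- The entrywise product representation is defined over the algebraic closure only, but with respect
to the basis `v = (1, 1)`, `P_1 v` the generators act by matrices over `K`. -/
theorem exists_twoDim {j : ℕ} (hj : 1 ≤ j) : ∃ ρ : Rep K (NSHecke s3 K j) (Fin 2 → K),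
    IsX s3 ρ ((qTwoK K ^ j * chebA K j) ^ 2) := by
  have := charZero_of_isFractionRing K
  obtain ⟨z, hz0, hz1, hz2, hz3, hz4⟩ := exists_root_parameter K
  have hqL : algebraMap Ground (AlgebraicClosure K) qTwo =
      algebraMap K (AlgebraicClosure K) (qTwoK K) :=
    IsScalarTower.algebraMap_apply Ground K (AlgebraicClosure K) qTwo
  rw [← hqL] at hz3
  obtain ⟨φ, hφ⟩ := exists_hecke_twoDim hz0 hz3
  have hq0 : algebraMap Ground (AlgebraicClosure K) qTwo ^ j ≠ 0 := by
    rw [hqL]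
    exact pow_ne_zero _ ((map_ne_zero _).mpr (qTwoK_ne_zero K))
  set Q := algebraMap Ground (AlgebraicClosure K) qTwo ^ j with hQ
  have hQK : algebraMap K (AlgebraicClosure K) (qTwoK K ^ j) = Q := by rw [map_pow, hQ, hqL]
  have hzj := hz4 j
  have hzz : z ^ j * z⁻¹ ^ j = 1 := by rw [← mul_pow, mul_inv_cancel₀ hz0, one_pow]
  have hne : z ^ j - z⁻¹ ^ j ≠ 0 := by
    intro h
    have h1 : algebraMap K (AlgebraicClosure K) (chebA K j ^ 2 * (chebA K j ^ 2 - 1)) = 0 := by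
      rw [map_mul, map_sub, map_one]
      linear_combination (algebraMap K (AlgebraicClosure K) (chebA K j ^ 2) / 4 +
        (z ^ j + z⁻¹ ^ j - 2) / 16) * hzj + (z ^ j - z⁻¹ ^ j) / 16 * h + hzz / 4
    rw [map_eq_zero] at h1
    rcases mul_eq_zero.mp h1 with h1 | h1
    · exact chebA_sq_ne_zero K j h1
    · exact chebA_sq_ne_one K hj (sub_eq_zero.mp h1)
  let C : Matrix (Fin 2) (Fin 2) (AlgebraicClosure K) :=
    !![1, Q / 2 * (1 + z⁻¹ ^ j); 1, Q / 2 * (1 + z ^ j)]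
  have hdet : IsUnit C.det := by
    have : C.det = Q / 2 * (z ^ j - z⁻¹ ^ j) := by
      rw [Matrix.det_fin_two_of]; ring
    rw [this, isUnit_iff_ne_zero]
    exact mul_ne_zero (div_ne_zero hq0 two_ne_zero) hne
  have hC : C * C⁻¹ = 1 := Matrix.mul_nonsing_inv C hdet
  let ι : Matrix (Fin 2) (Fin 2) K →ₐ[Ground] Matrix (Fin 2) (Fin 2) (AlgebraicClosure K) :=
    (IsScalarTower.toAlgHom Ground K (AlgebraicClosure K)).mapMatrix
  have hι : Function.Injective ι := by
    intro A B h
    ext a b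
    exact (algebraMap K (AlgebraicClosure K)).injective (congrFun (congrFun h a) b)
  have hxi : ∀ i, hadamard φ j (powP s3 j i) * C =
      C * ι (xMatrix K j ((qTwoK K ^ j * chebA K j) ^ 2) i) := by
    intro i
    have hc : algebraMap K (AlgebraicClosure K) ((qTwoK K ^ j * chebA K j) ^ 2) =
        Q ^ 2 / 4 * (z ^ j + z⁻¹ ^ j + 2) := by
      rw [mul_pow, map_mul, map_pow, hQK, ← hzj]; ring
    have hx : ∀ a b c d : K, ι !![a, b; c, d] = !![algebraMap K (AlgebraicClosure K) a,
        algebraMap K _ b; algebraMap K _ c, algebraMap K _ d] := by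
      intro a b c d
      ext l m
      fin_cases l <;> fin_cases m <;> rfl
    rw [hadamard_powP hφ hj, ← hQ]
    revert i
    refine Fin.forall_fin_two.mpr ⟨?_, ?_⟩
    · have h0 : ∀ c, xMatrix K j c 0 = !![qTwoK K ^ j, c; 0, 0] := fun c => rfl
      simp only [h0, hx, hc, hQK, map_zero, C, Fin.val_zero, pow_zero, inv_one, one_pow,
        Matrix.mul_fin_two]
      refine matrix_fin_two_congr ?_ ?_ ?_ ?_
      · ring
      · linear_combination
      · ring
      · linear_combination
    · have h1 : ∀ c, xMatrix K j c 1 = !![0, 0; 1, qTwoK K ^ j] := fun c => rfl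
      simp only [h1, hx, hQK, map_zero, map_one, C, Fin.val_one, pow_one, Matrix.mul_fin_two]
      refine matrix_fin_two_congr ?_ ?_ ?_ ?_
      · ring
      · linear_combination Q ^ 2 / 4 * hzz
      · ring
      · linear_combination Q ^ 2 / 4 * hzz
  obtain ⟨ρ, hρ⟩ := exists_lift_of_adjoin (hadamardHom hφ hj hC) ι hι (genP s3 j)
    (adjoin_range_genP j) (xMatrix K j ((qTwoK K ^ j * chebA K j) ^ 2))
    (fun i => hadamardHom_genP hφ hj hC (hxi i))
  refine ⟨(Matrix.toLinAlgEquiv' (R := K) (n := Fin 2)).toAlgHom.comp (extendScalars Ground K ρ),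
    fun i => ?_⟩
  have h1 : extendScalars Ground K ρ (P s3 K j i) = _ :=
    (extendScalars_tmul Ground K ρ _).trans (hρ i)
  exact congrArg (Matrix.toLinAlgEquiv' (R := K) (n := Fin 2)) h1

end Descent

/-! ### Modules over the nonstandard Hecke algebra -/

section Modules

section RepSpace

variable {K : Type} [Field K] {R : Type} [Ring R] [Algebra K R]
variable {V : Type} [AddCommGroup V] [Module K V] (ρ : Rep K R V)

instance : Module K (RepSpace ρ) := inferInstanceAs (Module K V)

instance : IsScalarTower K R (RepSpace ρ) :=
  ⟨fun c r v => LinearMap.congr_fun (map_smul ρ c r) v⟩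

theorem smul_charRep (χ : R →ₐ[K] K) (a : R) (x : RepSpace (charRep χ)) : a • x = χ a • x := rfl

end RepSpace

variable {K : Type} [Field K] [Algebra Ground K] {k : ℕ}

section General

variable {V V' : Type*} [AddCommGroup V] [Module (NSHecke s3 K k) V] [Module K V]
  [IsScalarTower K (NSHecke s3 K k) V] [AddCommGroup V'] [Module (NSHecke s3 K k) V'] [Module K V']
  [IsScalarTower K (NSHecke s3 K k) V']

theorem smul_mem_submodule (U : Submodule (NSHecke s3 K k) V) (c : K) {x : V} (hx : x ∈ U) :
    c • x ∈ U := by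
  rw [← algebraMap_smul (NSHecke s3 K k) c x]
  exact U.smul_mem _ hx

/-- The module with basis `b` in which the idempotents act by the matrices `(1, d'; 0, 0)` and
`(0, 0; d, 1)`. -/
structure IsTwoDim (k : ℕ) [Module (NSHecke s3 K k) V] (b : Module.Basis (Fin 2) K V) (d d' : K) :
    Prop where
  idem_zero_zero : idem K k 0 • b 0 = b 0
  idem_one_zero : idem K k 1 • b 0 = d • b 1
  idem_zero_one : idem K k 0 • b 1 = d' • b 0
  idem_one_one : idem K k 1 • b 1 = b 1

/-- On the two-dimensional module, `e₀ e₁ e₀ = d d' e₀`. -/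
theorem IsTwoDim.idem_smul {b : Module.Basis (Fin 2) K V} {d d' : K} (h : IsTwoDim k b d d') (x : V) :
    idem K k 0 • idem K k 1 • idem K k 0 • x = (d * d') • idem K k 0 • x := by
  obtain ⟨h00, h10, h01, h11⟩ := h
  have hexp : x = b.repr x 0 • b 0 + b.repr x 1 • b 1 := by
    conv_lhs => rw [← b.sum_repr x]
    rw [Fin.sum_univ_two]
  have e0 : idem K k 0 • x = (b.repr x 0 + b.repr x 1 * d') • b 0 := by
    conv_lhs => rw [hexp]
    rw [smul_add, smul_comm (idem K k 0), smul_comm (idem K k 0), h00, h01, smul_smul, add_smul]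
  rw [e0, smul_comm (idem K k 1), h10, smul_comm (idem K k 0), smul_comm (idem K k 0), h01]
  simp only [smul_smul]
  congr 1
  ring

theorem IsTwoDim.isSimpleModule {b : Module.Basis (Fin 2) K V} {d d' : K}
    (h : IsTwoDim k b d d') (h0 : d * d' ≠ 0) (h1 : d * d' ≠ 1) :
    IsSimpleModule (NSHecke s3 K k) V := by
  obtain ⟨h00, h10, h01, h11⟩ := h
  have hd : d ≠ 0 := left_ne_zero_of_mul h0
  have hd' : d' ≠ 0 := right_ne_zero_of_mul h0
  have : Nontrivial V := ⟨b 0, 0, b.ne_zero 0⟩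
  have hexp : ∀ x : V, x = b.repr x 0 • b 0 + b.repr x 1 • b 1 := fun x => by
    conv_lhs => rw [← b.sum_repr x]
    rw [Fin.sum_univ_two]
  rw [isSimpleModule_iff]
  refine { eq_bot_or_eq_top := fun U => ?_ }
  rw [or_iff_not_imp_left]
  intro hU
  obtain ⟨x, hxU, hx⟩ := U.exists_mem_ne_zero_of_ne_bot hU
  have hdiv : ∀ (c : K) (y : V), c ≠ 0 → c • y ∈ U → y ∈ U := fun c y hc hy => by
    have := smul_mem_submodule U c⁻¹ hy
    rwa [smul_smul, inv_mul_cancel₀ hc, one_smul] at this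
  have hb01 : b 0 ∈ U → b 1 ∈ U := fun h =>
    hdiv d _ hd (h10 ▸ U.smul_mem (idem K k 1) h)
  have hb10 : b 1 ∈ U → b 0 ∈ U := fun h =>
    hdiv d' _ hd' (h01 ▸ U.smul_mem (idem K k 0) h)
  have hb : b 0 ∈ U ∧ b 1 ∈ U := by
    have e0 : idem K k 0 • x = (b.repr x 0 + b.repr x 1 * d') • b 0 := by
      conv_lhs => rw [hexp x]
      rw [smul_add, smul_comm (idem K k 0), smul_comm (idem K k 0), h00, h01, smul_smul, add_smul]
    have e1 : idem K k 1 • x = (b.repr x 0 * d + b.repr x 1) • b 1 := by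
      conv_lhs => rw [hexp x]
      rw [smul_add, smul_comm (idem K k 1), smul_comm (idem K k 1), h10, h11, smul_smul, add_smul]
    by_cases hc0 : b.repr x 0 + b.repr x 1 * d' = 0
    · by_cases hc1 : b.repr x 0 * d + b.repr x 1 = 0
      · exfalso
        have h2 : b.repr x 1 * (1 - d * d') = 0 := by linear_combination hc1 - d * hc0
        have h3 : b.repr x 1 = 0 :=
          (mul_eq_zero.mp h2).resolve_right (sub_ne_zero.mpr h1.symm)
        have h4 : b.repr x 0 = 0 := by simpa [h3] using hc0
        apply hx
        rw [hexp x, h3, h4, zero_smul, zero_smul, add_zero]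
      · have : b 1 ∈ U := hdiv _ _ hc1 (e1 ▸ U.smul_mem (idem K k 1) hxU)
        exact ⟨hb10 this, this⟩
    · have : b 0 ∈ U := hdiv _ _ hc0 (e0 ▸ U.smul_mem (idem K k 0) hxU)
      exact ⟨this, hb01 this⟩
  rw [eq_top_iff]
  intro y _
  rw [hexp y]
  exact U.add_mem (smul_mem_submodule U _ hb.1) (smul_mem_submodule U _ hb.2)

theorem IsTwoDim.eq_of_equiv {b : Module.Basis (Fin 2) K V} {d d' : K} (h : IsTwoDim k b d d')
    {b' : Module.Basis (Fin 2) K V'} {c c' : K} (h' : IsTwoDim k b' c c')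
    (e : V ≃ₗ[NSHecke s3 K k] V') : d * d' = c * c' := by
  have h1 := h'.idem_smul (e (b 0))
  rw [← map_smul e, ← map_smul e, ← map_smul e, h.idem_smul, h.idem_zero_zero,
    ← algebraMap_smul (NSHecke s3 K k) (d * d'), ← algebraMap_smul (NSHecke s3 K k) (c * c'),
    ← map_smul e] at h1
  have h2 := e.injective h1
  rw [algebraMap_smul, algebraMap_smul] at h2
  exact smul_left_injective K (b.ne_zero 0) h2

variable [IsFractionRing Ground K]

theorem P_eq_smul_idem (i : Fin 2) : P s3 K k i = qTwoK K ^ k • idem K k i := by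
  rw [idem, smul_smul, mul_inv_cancel₀ (pow_ne_zero _ (qTwoK_ne_zero K)), one_smul]

theorem adjoin_range_idem : Algebra.adjoin K (Set.range (idem K k)) = ⊤ := by
  rw [eq_top_iff, ← adjoin_range_P]
  refine Algebra.adjoin_le ?_
  rintro _ ⟨i, rfl⟩
  rw [P_eq_smul_idem]
  exact Subalgebra.smul_mem _ (Algebra.subset_adjoin (Set.mem_range_self i)) _

/-- A `K`-linear map that commutes with the two idempotents is a homomorphism of modules. -/
theorem exists_linearMap (f : V →ₗ[K] V') (hf : ∀ i x, f (idem K k i • x) = idem K k i • f x) :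
    ∃ g : V →ₗ[NSHecke s3 K k] V', ∀ x, g x = f x := by
  have h : ∀ (a : NSHecke s3 K k) x, f (a • x) = a • f x := by
    intro a
    have ha : a ∈ Algebra.adjoin K (Set.range (idem K k)) := by
      rw [adjoin_range_idem]; exact Algebra.mem_top
    induction ha using Algebra.adjoin_induction with
    | mem a ha =>
      obtain ⟨i, rfl⟩ := ha
      exact hf i
    | algebraMap c => intro x; rw [algebraMap_smul, algebraMap_smul, map_smul]
    | add a b _ _ ha hb => intro x; rw [add_smul, map_add, ha, hb, add_smul]
    | mul a b _ _ ha hb => intro x; rw [mul_smul, ha, hb, mul_smul]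
  exact ⟨{ toFun := f, map_add' := map_add f, map_smul' := h }, fun x => rfl⟩

/-- A simple module with a vector `v = e₀ v` on which `e₀ e₁` acts as `d d'` is isomorphic to the
two-dimensional module, if that is simple: the map with `b 0 ↦ v`, `b 1 ↦ d⁻¹ e₁ v` is a non-zero
homomorphism. -/
theorem IsTwoDim.nonempty_equiv [IsSimpleModule (NSHecke s3 K k) V]
    [IsSimpleModule (NSHecke s3 K k) V'] {b : Module.Basis (Fin 2) K V'} {d d' : K}
    (h : IsTwoDim k b d d') (hd : d ≠ 0) {v : V} (hv : v ≠ 0) (hv0 : idem K k 0 • v = v)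
    (hv1 : idem K k 0 • idem K k 1 • v = (d * d') • v) :
    Nonempty (V ≃ₗ[NSHecke s3 K k] V') := by
  obtain ⟨h00, h10, h01, h11⟩ := h
  let f : V' →ₗ[K] V := b.constr K ![v, d⁻¹ • idem K k 1 • v]
  have f0 : f (b 0) = v := by simp [f]
  have f1 : f (b 1) = d⁻¹ • idem K k 1 • v := by simp [f]
  have hf : ∀ i x, f (idem K k i • x) = idem K k i • f x := by
    intro i x
    have hl : f.comp (Algebra.lsmul K K V' (idem K k i)) =
        (Algebra.lsmul K K V (idem K k i)).comp f := by
      refine b.ext ?_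
      simp only [LinearMap.comp_apply, Algebra.lsmul_coe]
      revert i
      refine Fin.forall_fin_two.mpr ⟨Fin.forall_fin_two.mpr ⟨?_, ?_⟩,
        Fin.forall_fin_two.mpr ⟨?_, ?_⟩⟩
      · rw [h00, f0, hv0]
      · rw [h01, map_smul, f0, f1, smul_comm, hv1, smul_smul, ← mul_assoc, inv_mul_cancel₀ hd,
          one_mul]
      · rw [h10, map_smul, f0, f1, smul_smul, mul_inv_cancel₀ hd, one_smul]
      · rw [h11, f1, smul_comm, ← mul_smul, idem_mul_self]
    exact LinearMap.congr_fun hl x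
  obtain ⟨g, hg⟩ := exists_linearMap f hf
  have hg0 : g ≠ 0 := fun h0 => hv (by rw [← f0, ← hg, h0, LinearMap.zero_apply])
  exact ⟨(LinearEquiv.ofBijective g (LinearMap.bijective_of_ne_zero hg0)).symm⟩

end General

/-! ### The list of simple modules -/

theorem Q_eq (m : ℕ) (i : Fin 2) : Q s3 K m i = algebraMap K _ (qTwoK K ^ m) - P s3 K m i := by
  refine (map_sub (Algebra.TensorProduct.includeRight (R := Ground) (A := K)
    (B := nonstandardHecke s3 m)) (algebraMap _ _ (qTwo ^ m)) (genP s3 m i)).trans ?_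
  refine congrArg (· - P s3 K m i) ?_
  rw [AlgHom.commutes, qTwoK, ← map_pow]
  exact IsScalarTower.algebraMap_apply Ground K _ _

section OneDimModules

variable (χ : NSHecke s3 K k →ₐ[K] K)

theorem isSimpleModule_charRep : IsSimpleModule (NSHecke s3 K k) (RepSpace (charRep χ)) := by
  have : Nontrivial (RepSpace (charRep χ)) := inferInstanceAs (Nontrivial K)
  rw [isSimpleModule_iff]
  refine { eq_bot_or_eq_top := fun U => ?_ }
  rw [or_iff_not_imp_left]
  intro hU
  obtain ⟨x, hxU, hx⟩ := U.exists_mem_ne_zero_of_ne_bot hU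
  rw [eq_top_iff]
  intro y _
  obtain ⟨c, rfl⟩ : ∃ c : K, y = c • x :=
    ⟨@HDiv.hDiv K K K _ y x, (div_mul_cancel₀ (G₀ := K) y hx).symm⟩
  exact smul_mem_submodule U _ hxU

theorem apply_eq_of_equiv_charRep {V : Type*} [AddCommGroup V] [Module (NSHecke s3 K k) V] [Module K V]
    [IsScalarTower K (NSHecke s3 K k) V] (e : V ≃ₗ[NSHecke s3 K k] RepSpace (charRep χ))
    (a : NSHecke s3 K k) (x : V) : a • x = χ a • x := by
  apply e.injective
  rw [map_smul, smul_charRep, ← algebraMap_smul (NSHecke s3 K k) (χ a) x, map_smul, algebraMap_smul]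

variable [IsFractionRing Ground K]

theorem nonempty_equiv_charRep {V : Type*} [AddCommGroup V] [Module (NSHecke s3 K k) V] [Module K V]
    [IsScalarTower K (NSHecke s3 K k) V] [IsSimpleModule (NSHecke s3 K k) V] {v : V} (hv : v ≠ 0)
    (h : ∀ i, idem K k i • v = χ (idem K k i) • v) :
    Nonempty (V ≃ₗ[NSHecke s3 K k] RepSpace (charRep χ)) := by
  have := isSimpleModule_charRep χ
  let f : RepSpace (charRep χ) →ₗ[K] V := LinearMap.toSpanSingleton K V v
  obtain ⟨g, hg⟩ := exists_linearMap f (by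
    intro i x
    rw [smul_charRep, map_smul]
    have hx : f x = (show K from x) • v := rfl
    rw [hx, smul_comm (idem K k i), h, smul_comm])
  have hg0 : g ≠ 0 := fun h0 => hv (by
    have h1 := hg (show RepSpace (charRep χ) from (1 : K))
    rw [h0, LinearMap.zero_apply] at h1
    rw [← one_smul K v]
    exact h1.symm)
  exact ⟨(LinearEquiv.ofBijective g (LinearMap.bijective_of_ne_zero hg0)).symm⟩

end OneDimModules

variable [IsFractionRing Ground K]

theorem trivTensor_P {j : ℕ} (hj : j ≤ k) (σ : Rep K (NSHecke s3 K j) (Fin 2 → K)) (i : Fin 2)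
    (w : Fin 2 → K) : trivTensor s3 hj σ (P s3 K k i) ((1 : K) ⊗ₜ[K] w) =
      qTwoK K ^ (k - j) • ((1 : K) ⊗ₜ[K] σ (P s3 K j i) w) := by
  have hP : epsPlusPow s3 K (k - j) (P s3 K (k - j) i) (1 : K) = qTwoK K ^ (k - j) :=
    (mul_one _).trans (nsChar_heckePowTrivial_P K (k - j) i)
  have hQ : epsPlusPow s3 K (k - j) (Q s3 K (k - j) i) (1 : K) = 0 := by
    rw [Q_eq, map_sub, LinearMap.sub_apply, hP, AlgHom.commutes, Module.algebraMap_end_apply,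
      smul_eq_mul, mul_one, sub_self]
  rw [trivTensor, tensorRep, AlgHom.comp_apply, coproduct_P, AlgHom.comp_apply, map_tensor_add,
    map_add, LinearMap.add_apply, Module.endTensorEndAlgHom_apply, Module.endTensorEndAlgHom_apply]
  simp only [TensorProduct.AlgebraTensorModule.map_tmul]
  rw [hP, hQ, TensorProduct.zero_tmul, add_zero, TensorProduct.smul_tmul', smul_eq_mul, mul_one]

theorem exists_isTwoDim_trivTensor {j : ℕ} (hj : j ≤ k) {σ : Rep K (NSHecke s3 K j) (Fin 2 → K)}
    (hσ : IsX s3 σ ((qTwoK K ^ j * chebA K j) ^ 2)) :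
    ∃ (b : Module.Basis (Fin 2) K (RepSpace (trivTensor s3 hj σ))) (d d' : K),
      IsTwoDim k b d d' ∧ d * d' = chebA K j ^ 2 := by
  have hq : qTwoK K ≠ 0 := qTwoK_ne_zero K
  let b₀ : Module.Basis (Fin 2) K (K ⊗[K] (Fin 2 → K)) :=
    (Pi.basisFun K (Fin 2)).map (TensorProduct.lid K (Fin 2 → K)).symm
  let b : Module.Basis (Fin 2) K (RepSpace (trivTensor s3 hj σ)) := b₀
  have hb : ∀ l, b₀ l = (1 : K) ⊗ₜ[K] Pi.single l (1 : K) := fun l => by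
    simp [b₀]
  have hk : qTwoK K ^ k = qTwoK K ^ (k - j) * qTwoK K ^ j := by
    rw [← pow_add, Nat.sub_add_cancel hj]
  have hact : ∀ i l, idem K k i • b l = ((qTwoK K ^ j)⁻¹ * xMatrix K j
      ((qTwoK K ^ j * chebA K j) ^ 2) i 0 l) • b 0 +
      ((qTwoK K ^ j)⁻¹ * xMatrix K j ((qTwoK K ^ j * chebA K j) ^ 2) i 1 l) • b 1 := by
    intro i l
    have h1 : idem K k i • b l = (qTwoK K ^ k)⁻¹ • trivTensor s3 hj σ (P s3 K k i) (b₀ l) := by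
      rw [idem, smul_assoc]
      rfl
    have h2 : (xMatrix K j ((qTwoK K ^ j * chebA K j) ^ 2) i).mulVec (Pi.single l (1 : K)) =
        xMatrix K j ((qTwoK K ^ j * chebA K j) ^ 2) i 0 l • Pi.single 0 (1 : K) +
        xMatrix K j ((qTwoK K ^ j * chebA K j) ^ 2) i 1 l • Pi.single 1 (1 : K) := by
      ext m
      rw [Matrix.mulVec_single_one]
      fin_cases m <;> simp
    rw [h1, hb, trivTensor_P, hσ, Matrix.toLin'_apply, h2, TensorProduct.tmul_add,
      TensorProduct.tmul_smul, TensorProduct.tmul_smul, ← hb, ← hb, smul_smul, smul_add, smul_smul,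
      smul_smul]
    have h3 : (qTwoK K ^ k)⁻¹ * qTwoK K ^ (k - j) = (qTwoK K ^ j)⁻¹ := by
      rw [hk]
      field_simp
    rw [h3]
    rfl
  have hqj : (qTwoK K ^ j)⁻¹ * qTwoK K ^ j = 1 := inv_mul_cancel₀ (pow_ne_zero _ hq)
  refine ⟨b, (qTwoK K ^ j)⁻¹, (qTwoK K ^ j)⁻¹ * (qTwoK K ^ j * chebA K j) ^ 2,
    ⟨?_, ?_, ?_, ?_⟩, ?_⟩
  · rw [hact]; simp [xMatrix, hqj]
  · rw [hact]; simp [xMatrix]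
  · rw [hact]; simp [xMatrix]
  · rw [hact]; simp [xMatrix, hqj]
  · linear_combination (chebA K j ^ 2) * (1 + (qTwoK K ^ j)⁻¹ * qTwoK K ^ j) * hqj

/-! ### The classification -/

/-- The central element acts on a simple module by one of the scalars `T_j(1 / [2])²`, `0 ≤ j ≤ k`. -/
theorem exists_centralElt_smul (V : Type*) [AddCommGroup V] [Module (NSHecke s3 K k) V] [Module K V]
    [IsScalarTower K (NSHecke s3 K k) V] [IsSimpleModule (NSHecke s3 K k) V] :
    ∃ j ≤ k, ∀ v : V, centralElt K k • v = chebA K j ^ 2 • v := by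
  have hE0 : ∀ v : V, idem K k 0 • idem K k 0 • v = idem K k 0 • v := fun v => by
    rw [← mul_smul, idem_mul_self]
  have hE1 : ∀ v : V, idem K k 1 • idem K k 1 • v = idem K k 1 • v := fun v => by
    rw [← mul_smul, idem_mul_self]
  let Z : V →ₗ[K] V := Algebra.lsmul K K V (centralElt K k)
  have hZ : ∀ i (v : V), Z (idem K k i • v) = idem K k i • Z v := by
    intro i v
    change centralElt K k • idem K k i • v = idem K k i • centralElt K k • v
    revert i
    refine Fin.forall_fin_two.mpr ⟨?_, ?_⟩ <;>
    · simp only [centralElt, add_smul, sub_smul, mul_smul, one_smul, smul_add, smul_sub, hE0, hE1]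
      abel
  have : Nontrivial V := IsSimpleModule.nontrivial (NSHecke s3 K k) V
  obtain ⟨v, hv⟩ := exists_ne (0 : V)
  have hker : ∃ j ≤ k, ∃ w : V, w ≠ 0 ∧ centralElt K k • w = chebA K j ^ 2 • w := by
    by_contra! hcon
    have h : ∀ n ≤ k + 1, Polynomial.aeval (centralElt K k) (∏ j ∈ Finset.range n,
        (Polynomial.X - Polynomial.C (chebA K j ^ 2))) • v ≠ 0 := by
      intro n
      induction n with
      | zero => intro _; simpa using hv
      | succ n ih =>
        intro hn h0
        refine hcon n (by omega) _ (ih (by omega)) ?_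
        rw [Finset.prod_range_succ_comm, map_mul, mul_smul, map_sub, Polynomial.aeval_X,
          Polynomial.aeval_C, sub_smul, algebraMap_smul, sub_eq_zero] at h0
        exact h0
    exact h (k + 1) le_rfl (by rw [aeval_centralElt]; exact zero_smul (NSHecke s3 K k) v)
  obtain ⟨j, hj, w, hw, hjw⟩ := hker
  refine ⟨j, hj, fun v => ?_⟩
  obtain ⟨g', hg'⟩ := exists_linearMap (Z - chebA K j ^ 2 • LinearMap.id) (fun i x => by
    simp only [LinearMap.sub_apply, LinearMap.smul_apply, LinearMap.id_apply, smul_sub]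
    rw [smul_comm (idem K k i)]
    exact congrArg (· - _) (hZ i x))
  have hg'0 : g' = 0 := by
    refine (LinearMap.bijective_or_eq_zero g').resolve_left fun hbij => hw (hbij.1 ?_)
    rw [hg', map_zero, LinearMap.sub_apply, sub_eq_zero]
    exact hjw
  have h1 := hg' v
  rw [hg'0, LinearMap.zero_apply, LinearMap.sub_apply] at h1
  exact (sub_eq_zero.mp h1.symm)

/-- A simple module is one of the two characters, or contains a vector `v = e₀ v ≠ 0` on which `e₀ e₁`
acts by `T_j(1 / [2])²` for some `1 ≤ j ≤ k`. -/
theorem equiv_character_or_exists_eigenvector {χp χm : NSHecke s3 K k →ₐ[K] K}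
    (hp : ∀ i, χp (idem K k i) = 1) (hm : ∀ i, χm (idem K k i) = 0)
    (V : Type*) [AddCommGroup V] [Module (NSHecke s3 K k) V] [Module K V]
    [IsScalarTower K (NSHecke s3 K k) V] [IsSimpleModule (NSHecke s3 K k) V] :
    Nonempty (V ≃ₗ[NSHecke s3 K k] RepSpace (charRep χp)) ∨
      Nonempty (V ≃ₗ[NSHecke s3 K k] RepSpace (charRep χm)) ∨
      ∃ j ≤ k, 1 ≤ j ∧ ∃ v : V, v ≠ 0 ∧ idem K k 0 • v = v ∧
        idem K k 0 • idem K k 1 • v = chebA K j ^ 2 • v := by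
  have hE : ∀ i (v : V), idem K k i • idem K k i • v = idem K k i • v := fun i v => by
    rw [← mul_smul, idem_mul_self]
  obtain ⟨j, hj, hZ⟩ := exists_centralElt_smul (K := K) (k := k) V
  simp only [centralElt, add_smul, sub_smul, mul_smul, one_smul] at hZ
  have hneg : ∀ v : V, v ≠ 0 → (∀ i, idem K k i • v = 0) →
      Nonempty (V ≃ₗ[NSHecke s3 K k] RepSpace (charRep χm)) := fun v hv h =>
    nonempty_equiv_charRep χm hv fun i => by rw [h, hm, zero_smul]
  by_cases h0 : ∃ v : V, idem K k 0 • v ≠ 0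
  · obtain ⟨w, hw⟩ := h0
    have hv1 : idem K k 0 • idem K k 1 • idem K k 0 • w = chebA K j ^ 2 • idem K k 0 • w := by
      rw [← hZ]
      simp only [hE]
      abel
    rcases Nat.eq_zero_or_pos j with rfl | hj1
    · -- here `e₀` fixes `e₁ e₀ w`, so both idempotents annihilate `e₁ e₀ w - e₀ w`
      rw [chebA_zero, one_pow, one_smul] at hv1
      by_cases hd : idem K k 1 • idem K k 0 • w - idem K k 0 • w = 0
      · refine Or.inl (nonempty_equiv_charRep χp hw (Fin.forall_fin_two.mpr ⟨?_, ?_⟩))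
        · rw [hp, one_smul, hE]
        · rw [hp, one_smul, sub_eq_zero.mp hd]
      · refine Or.inr (Or.inl (hneg _ hd (Fin.forall_fin_two.mpr ⟨?_, ?_⟩)))
        · rw [smul_sub, hv1, hE, sub_self]
        · rw [smul_sub, hE, sub_self]
    · exact Or.inr (Or.inr ⟨j, hj, hj1, _, hw, hE 0 w, hv1⟩)
  · push Not at h0
    by_cases h1 : ∃ v : V, idem K k 1 • v ≠ 0
    · -- the central element would annihilate `e₁ w`, but its eigenvalue is not zero
      obtain ⟨w, hw⟩ := h1
      have h2 := hZ (idem K k 1 • w)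
      simp only [h0, hE, smul_zero] at h2
      have h3 : chebA K j ^ 2 • idem K k 1 • w = 0 := by
        rw [← h2]; abel
      exact absurd h3 (smul_ne_zero (chebA_sq_ne_zero K j) hw)
    · push Not at h1
      have : Nontrivial V := IsSimpleModule.nontrivial (NSHecke s3 K k) V
      obtain ⟨v, hv⟩ := exists_ne (0 : V)
      exact Or.inr (Or.inl (hneg v hv (Fin.forall_fin_two.mpr ⟨h0 v, h1 v⟩)))

end Modules

end NonstandardHecke

open NonstandardHecke in
theorem theoremt (K : Type) [Field K] [Algebra Ground K] [IsFractionRing Ground K]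
    (k : ℕ) (hk : 1 ≤ k) :
    ∃ (εp εm : NSHecke s3 K k →ₐ[K] K)
      (M : (j : ℕ) → Rep K (NSHecke s3 K j) (Fin 2 → K)),
      -- the trivial and the sign representation, and the representations `M^{(j)}`
      (∀ i, εp (P s3 K k i) = qTwoK K ^ k) ∧
      (∀ i, εm (P s3 K k i) = 0) ∧
      (∀ j, 1 ≤ j → IsX s3 (M j) ((qTwoK K ^ j * chebA K j) ^ 2)) ∧
      -- these two and the `ε₊ ⊗ ⋯ ⊗ ε₊ ⊗ M^{(j)}`, `1 ≤ j ≤ k`, with `k - j` factors `ε₊`, are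
      -- irreducible
      IsSimpleModule (NSHecke s3 K k) (RepSpace (charRep εp)) ∧
      IsSimpleModule (NSHecke s3 K k) (RepSpace (charRep εm)) ∧
      (∀ j (hj : j ≤ k), 1 ≤ j → IsSimpleModule (NSHecke s3 K k) (RepSpace (trivTensor s3 hj (M j)))) ∧
      -- no two of them are isomorphic
      IsEmpty (RepSpace (charRep εp) ≃ₗ[NSHecke s3 K k] RepSpace (charRep εm)) ∧
      (∀ j (hj : j ≤ k), 1 ≤ j →
        IsEmpty (RepSpace (trivTensor s3 hj (M j)) ≃ₗ[NSHecke s3 K k] RepSpace (charRep εp)) ∧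
        IsEmpty (RepSpace (trivTensor s3 hj (M j)) ≃ₗ[NSHecke s3 K k] RepSpace (charRep εm))) ∧
      (∀ i j (hi : i ≤ k) (hj : j ≤ k), 1 ≤ i → 1 ≤ j → i ≠ j →
        IsEmpty (RepSpace (trivTensor s3 hi (M i)) ≃ₗ[NSHecke s3 K k] RepSpace (trivTensor s3 hj (M j)))) ∧
      -- every irreducible representation is isomorphic to one of them
      ∀ (V : Type*) [AddCommGroup V] [Module (NSHecke s3 K k) V],
        IsSimpleModule (NSHecke s3 K k) V →
          Nonempty (V ≃ₗ[NSHecke s3 K k] RepSpace (charRep εp)) ∨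
          Nonempty (V ≃ₗ[NSHecke s3 K k] RepSpace (charRep εm)) ∨
          ∃ (j : ℕ) (hj : j ≤ k), 1 ≤ j ∧
            Nonempty (V ≃ₗ[NSHecke s3 K k] RepSpace (trivTensor s3 hj (M j))) := by
  have hq : qTwoK K ^ k ≠ 0 := pow_ne_zero _ (qTwoK_ne_zero K)
  obtain ⟨εm, hm⟩ := exists_sign_character K hk
  -- the representation for `j = 0` is immaterial
  have hM : ∀ j, ∃ ρ : Rep K (NSHecke s3 K j) (Fin 2 → K), 1 ≤ j →
      IsX s3 ρ ((qTwoK K ^ j * chebA K j) ^ 2) := by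
    intro j
    by_cases hj : 1 ≤ j
    · obtain ⟨ρ, hρ⟩ := exists_twoDim K hj
      exact ⟨ρ, fun _ => hρ⟩
    · exact ⟨(Algebra.ofId K _).comp (nsChar K (heckePowTrivial s3 j)), fun h => absurd h hj⟩
  choose M hM using hM
  let εp := nsChar K (heckePowTrivial s3 k)
  have hp : ∀ i, εp (P s3 K k i) = qTwoK K ^ k := nsChar_heckePowTrivial_P K k
  have hpi : ∀ i, εp (idem K k i) = 1 := fun i => by
    rw [idem, map_smul, hp, smul_eq_mul, inv_mul_cancel₀ hq]
  have hmi : ∀ i, εm (idem K k i) = 0 := fun i => by rw [idem, map_smul, hm, smul_zero]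
  have hb := fun j (hj : j ≤ k) (hj1 : 1 ≤ j) => exists_isTwoDim_trivTensor hj (hM j hj1)
  have hsimple : ∀ j (hj : j ≤ k), 1 ≤ j →
      IsSimpleModule (NSHecke s3 K k) (RepSpace (trivTensor s3 hj (M j))) := by
    intro j hj hj1
    obtain ⟨b, d, d', h, hd⟩ := hb j hj hj1
    exact h.isSimpleModule (hd ▸ chebA_sq_ne_zero K j) (hd ▸ chebA_sq_ne_one K hj1)
  refine ⟨εp, εm, M, hp, hm, hM, isSimpleModule_charRep εp, isSimpleModule_charRep εm, hsimple,
    ⟨fun e => ?_⟩, fun j hj hj1 => ⟨⟨fun e => ?_⟩, ⟨fun e => ?_⟩⟩,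
    fun i j hi hj hi1 hj1 hij => ⟨fun e => ?_⟩, ?_⟩
  · have h := apply_eq_of_equiv_charRep εm e (idem K k 0)
    simp only [smul_charRep, hpi, hmi, one_smul, zero_smul] at h
    exact one_ne_zero (α := K) (h (1 : K))
  · -- `e₀` is not the identity, as it maps `b 1` to a multiple of `b 0`
    obtain ⟨b, d, d', h, hd⟩ := hb j hj hj1
    have h1 := apply_eq_of_equiv_charRep εp e (idem K k 0) (b 1)
    rw [h.idem_zero_one, hpi, one_smul] at h1
    have h2 := congrArg (fun x => b.repr x 1) h1
    simp at h2
  · obtain ⟨b, d, d', h, hd⟩ := hb j hj hj1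
    have h1 := apply_eq_of_equiv_charRep εm e (idem K k 0) (b 0)
    rw [h.idem_zero_zero, hmi, zero_smul] at h1
    exact b.ne_zero 0 h1
  · obtain ⟨b, d, d', h, hd⟩ := hb i hi hi1
    obtain ⟨b', c, c', h', hc⟩ := hb j hj hj1
    exact hij (chebA_sq_injective K (hd.symm.trans ((h.eq_of_equiv h' e).trans hc)))
  · intro V _ _ _
    let _ : Module K V := Module.compHom V (algebraMap K (NSHecke s3 K k))
    have : IsScalarTower K (NSHecke s3 K k) V := ⟨fun c a v =>
      (congrArg (· • v) (Algebra.smul_def c a)).trans (mul_smul _ _ _)⟩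
    rcases equiv_character_or_exists_eigenvector hpi hmi V with h | h | ⟨j, hj, hj1, v, hv, hv0, hv1⟩
    · exact Or.inl h
    · exact Or.inr (Or.inl h)
    · obtain ⟨b, d, d', h, hd⟩ := hb j hj hj1
      have := hsimple j hj hj1
      have hd0 : d ≠ 0 := left_ne_zero_of_mul (hd ▸ chebA_sq_ne_zero K j)
      exact Or.inr (Or.inr ⟨j, hj, hj1, h.nonempty_equiv hd0 hv hv0 (by rw [hd, hv1])⟩)
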